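/- **Theorem (order conditions for exponential-W methods).** Consider an $s$-stage exponential-W method with real coefficients $\gamma$, $b_i$, $\alpha_{ij}$, $\gamma_{ij}$ ($1\le i,j\le s$, with $\alpha_{ij}=\gamma_{ij}=0$ for $j\ge i$): for $y'=f(y)$ in $\mathbb{R}^N$, a matrix $\mathbf A\in\mathbb{R}^{N\times N}$ and a step size $h$, $$k_i=\varphi(h\gamma\mathbf A)\Big(h f\big(y_n+\sum_{j<i}\alpha_{ij}k_j\big)+h\mathbf A\sum_{j<i}\gamma_{ij}k_j\Big),\qquad y_{n+1}=y_n+\sum_{i=1}^s b_ik_i,\qquad \varphi(z)=\frac{e^z-1}{z}=\sum_{m\ge0}\frac{z^m}{(m+1)!}.$$ The method has *order* $p$ if for all $N$, all $f$ smooth near the initial value, all solutions $y$ of $y'=f(y)$ and all (arbitrary) matrices $\mathbf A$, one step from $y(t_0)$ satisfies $y_1-y(t_0+h)=O(h^{p+1})$ as $h\to0^+$. A *TW-tree* is a rooted tree (the order of children being immaterial) with two kinds of vertices, meagre and fat, in which end vertices are meagre and each fat vertex has exactly one child; $|\tau|$ is the number of vertices. Let $\Phi_j(\tau)$ be the sum,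 over all labels in $\{1,\dots,s\}$ of the non-root vertices, the root having the label $j$, of the product over all edges from a parent labelled $k$ to a child labelled $l$ of $\alpha_{kl}$ if the parent is meagre and $\gamma_{kl}$ if it is fat. Let $$P_\tau(\gamma)=\frac{1}{\rho(\tau^\circ)}\prod_{c}\frac{(-\gamma)^{n_c}}{n_c+1},$$ where $c$ runs through the maximal chains of consecutive fat vertices of $\tau$, $n_c$ is the number of vertices of $c$, $\tau^\circ$ is the tree obtained by contracting all fat vertices, and $\rho$ is the density (the product over all vertices $v$ of the number of vertices of the subtree rooted at $v$). 1. For every $p$, the method has order $p$ if and only if $$\sum_j b_j\,\Phi_j(\tau)=P_\tau(\gamma)\qquad\text{for all TW-trees }\tau\text{ with }|\tau|\le p .$$ 2. These conditions are the result of the stage-by-stage B-series computation. For B-series $\sum_\tau a(\tau)\frac{h^{|\tau|}}{\sigma(\tau)}F(\tau)$, with $\sigma(\tau)$ the symmetry and $F(\tau)$ the elementary differential of $\tau$, let $\mathsf k_j(\tau)$ be the coefficients of $k_j$ computed from the definition of the method with the rules for $hf(\cdot)$, $h\mathbf A\,\cdot$ and $\varphi(h\gamma\mathbf A)\,\cdot$,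 and let $e(\tau)$ be those of the exact solution ($1/\rho(\tau)$ if $\tau$ has no fat vertex, and $0$ otherwise). If the conditions hold for all TW-trees with fewer vertices than $\tau$, then $\sum_jb_j\mathsf k_j(\tau)-e(\tau)=\sum_jb_j\Phi_j(\tau)-P_\tau(\gamma)$. 3. There are exactly 21 TW-trees with $|\tau|\le4$, with the following $\Phi_j$ and $P_\tau(\gamma)$ (sums over all indices but $j$), so for $p\le4$ order $p$ is equivalent to those of the 21 conditions $\sum_j b_j\Phi_j=P_\tau(\gamma)$ that have $|\tau|\le p$. A tree is described by its elementary differential; a meagre vertex is a derivative of $f$, a fat vertex a factor $\mathbf A$: | $\tau$ | $\Phi_j$ | $P_\tau(\gamma)$ | |---|---|---| | $f$ | $1$ | $1$ | | $f'f$ | $\sum\alpha_{jk}$ | $\frac12$ | | $\mathbf Af$ | $\sum\gamma_{jk}$ | $-\frac{\gamma}2$ | | $f''(f,f)$ | $\sum\alpha_{jk}\alpha_{jl}$ | $\frac13$ | | $f'f'f$ | $\sum\alpha_{jk}\alpha_{kl}$ | $\frac16$ | | $f'\mathbf Af$ | $\sum\alpha_{jk}\gamma_{kl}$ | $-\frac{\gamma}4$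 | | $\mathbf Af'f$ | $\sum\gamma_{jk}\alpha_{kl}$ | $-\frac{\gamma}4$ | | $\mathbf A\mathbf Af$ | $\sum\gamma_{jk}\gamma_{kl}$ | $\frac{\gamma^2}3$ | | $f'''(f,f,f)$ | $\sum\alpha_{jk}\alpha_{jl}\alpha_{jm}$ | $\frac14$ | | $f''(f,f'f)$ | $\sum\alpha_{jk}\alpha_{jl}\alpha_{lm}$ | $\frac18$ | | $f''(f,\mathbf Af)$ | $\sum\alpha_{jk}\alpha_{jl}\gamma_{lm}$ | $-\frac{\gamma}6$ | | $f'f''(f,f)$ | $\sum\alpha_{jk}\alpha_{kl}\alpha_{km}$ | $\frac1{12}$ | | $\mathbf Af''(f,f)$ | $\sum\gamma_{jk}\alpha_{kl}\alpha_{km}$ | $-\frac{\gamma}6$ | | $f'f'f'f$ | $\sum\alpha_{jk}\alpha_{kl}\alpha_{lm}$ | $\frac1{24}$ | | $f'f'\mathbf Af$ | $\sum\alpha_{jk}\alpha_{kl}\gamma_{lm}$ | $-\frac{\gamma}{12}$ | | $f'\mathbf Af'f$ | $\sum\alpha_{jk}\gamma_{kl}\alpha_{lm}$ | $-\frac{\gamma}{12}$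 | | $f'\mathbf A\mathbf Af$ | $\sum\alpha_{jk}\gamma_{kl}\gamma_{lm}$ | $\frac{\gamma^2}6$ | | $\mathbf Af'f'f$ | $\sum\gamma_{jk}\alpha_{kl}\alpha_{lm}$ | $-\frac{\gamma}{12}$ | | $\mathbf Af'\mathbf Af$ | $\sum\gamma_{jk}\alpha_{kl}\gamma_{lm}$ | $\frac{\gamma^2}8$ | | $\mathbf A\mathbf Af'f$ | $\sum\gamma_{jk}\gamma_{kl}\alpha_{lm}$ | $\frac{\gamma^2}6$ | | $\mathbf A\mathbf A\mathbf Af$ | $\sum\gamma_{jk}\gamma_{kl}\gamma_{lm}$ | $-\frac{\gamma^3}4$ | -/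

import Mathlib

open Filter Topology Asymptotics
open scoped ContDiff

noncomputable section

/-! ### Exponential-W methods -/

/-- Coefficients of an `s`-stage exponential-W method: the scalar `γ`, the weights `b`, and the
strictly lower triangular arrays `α = (α_ij)` and `Γ = (γ_ij)`. -/
structure ExpWMethod (s : ℕ) where
  γ : ℝ
  b : Fin s → ℝ
  α : Fin s → Fin s → ℝ
  Γ : Fin s → Fin s → ℝ
  α_eq_zero : ∀ i j, i ≤ j → α i j = 0
  Γ_eq_zero : ∀ i j, i ≤ j → Γ i j = 0

/-- The entire function `φ(z) = (e^z - 1) / z = ∑ zⁿ / (n + 1)!` applied to an operator. -/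
def phiOp {E : Type*} [NormedAddCommGroup E] [NormedSpace ℝ E] (B : E →L[ℝ] E) : E →L[ℝ] E :=
  ∑' n : ℕ, ((n + 1).factorial : ℝ)⁻¹ • B ^ n

namespace ExpWMethod

variable {s : ℕ} (M : ExpWMethod s)

/-- The stages
`k_i = φ(hγA) (h f(y + ∑_{j < i} α_ij k_j) + h A ∑_{j < i} γ_ij k_j)`. -/
def stage {E : Type*} [NormedAddCommGroup E] [NormedSpace ℝ E]
    (f : E → E) (A : E →L[ℝ] E) (h : ℝ) (y : E) (i : Fin s) : E :=
  phiOp ((h * M.γ) • A)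
    (h • f (y + ∑ j : Set.Iio i, M.α i j • stage f A h y j) +
      h • A (∑ j : Set.Iio i, M.Γ i j • stage f A h y j))
termination_by i.val
decreasing_by all_goals exact j.2

/-- One step `y ↦ y + ∑ b_i k_i` of the method with step size `h`. -/
def step {E : Type*} [NormedAddCommGroup E] [NormedSpace ℝ E]
    (f : E → E) (A : E →L[ℝ] E) (h : ℝ) (y : E) : E :=
  y + ∑ i, M.b i • M.stage f A h y i

/-- The method has order (at least) `p`: for every autonomous system `y' = f(y)` in `ℝ^N` with `f`
smooth near the initial value, every solution `y`, and every matrix `A` (no relation between `A`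
and the Jacobian of `f` is required), the local error is `O(h^(p+1))` as `h → 0`, `h > 0`. -/
def HasOrder (p : ℕ) : Prop :=
  ∀ (N : ℕ) (f : (Fin N → ℝ) → (Fin N → ℝ)) (A : (Fin N → ℝ) →L[ℝ] (Fin N → ℝ))
    (t₀ : ℝ) (y : ℝ → Fin N → ℝ),
    ContDiffAt ℝ ∞ f (y t₀) →
    (∀ᶠ t in 𝓝 t₀, HasDerivAt y (f (y t)) t) →
    (fun h : ℝ => M.step f A h (y t₀) - y (t₀ + h)) =O[𝓝[>] 0] fun h : ℝ => h ^ (p + 1)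

end ExpWMethod

/-! ### TW-trees -/

/-- Plane representatives of TW-trees. A meagre vertex has any finite number of children, a fat
vertex has exactly one child; in particular all end vertices are meagre. -/
inductive PlaneTW : Type
  | meagre : List PlaneTW → PlaneTW
  | fat : PlaneTW → PlaneTW

namespace PlaneTW

/-- Elementary changes of a plane representative that do not change the underlying (unordered)
rooted two-coloured tree. -/
inductive Step : PlaneTW → PlaneTW → Prop
  | perm {l l' : List PlaneTW} : l.Perm l' → Step (meagre l) (meagre l')
  | child {t t' : PlaneTW} (l : List PlaneTW) :
      Step t t' → Step (meagre (t :: l)) (meagre (t' :: l))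
  | fat {t t' : PlaneTW} : Step t t' → Step (fat t) (fat t')

/-- The number of vertices. -/
def order : PlaneTW → ℕ
  | meagre l => 1 + (l.map order).sum
  | fat t => 1 + order t

/-- The number of meagre vertices. -/
def meagreCount : PlaneTW → ℕ
  | meagre l => 1 + (l.map meagreCount).sum
  | fat t => meagreCount t

/-- `Φ_j(τ)`: one factor `α_jk` for each edge from a meagre vertex `j` to a child `k`, one factor
`γ_jk` for each edge from a fat vertex `j` to its child `k`, summed over the labels of all vertices
except the root, which has the label `j`. -/
def Phi {s : ℕ} (M : ExpWMethod s) : PlaneTW → Fin s → ℝ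
  | meagre l, j => (l.map fun t => ∑ k, M.α j k * Phi M t k).prod
  | fat t, j => ∑ k, M.Γ j k * Phi M t k

/-- Auxiliary to `rhs`: the value for the tree obtained by putting `n` fat vertices in a row below
the root of the given tree. -/
def rhsAux (γ : ℝ) : ℕ → PlaneTW → ℝ
  | n, meagre l =>
      (-γ) ^ n / (n + 1) * ((l.map fun t => rhsAux γ 0 t).prod / meagreCount (meagre l))
  | n, fat t => rhsAux γ (n + 1) t

/-- The right-hand side `P_τ(γ)`: the reciprocal of the density of the tree that remains after all
fat vertices have been contracted, times one factor `(-γ)^n / (n + 1)` for each maximal chain of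
`n` consecutive fat vertices. -/
def rhs (γ : ℝ) (t : PlaneTW) : ℝ := rhsAux γ 0 t

/-- The coefficient of `τ` in the B-series `∑ a(τ) h^|τ| / σ(τ) F(τ)` of the exact solution: the
reciprocal of the density if all vertices are meagre, and zero otherwise. -/
def exactCoeff : PlaneTW → ℝ
  | meagre l => (l.map exactCoeff).prod / order (meagre l)
  | fat _ => 0

theorem Step.order_eq {t t' : PlaneTW} (h : Step t t') : order t = order t' := by
  induction h with
  | perm h => simp only [order]; rw [(h.map order).sum_eq]
  | child l _ ih => simp [order, ih]
  | fat _ ih => simp [order, ih]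

theorem Step.meagreCount_eq {t t' : PlaneTW} (h : Step t t') :
    meagreCount t = meagreCount t' := by
  induction h with
  | perm h => simp only [meagreCount]; rw [(h.map meagreCount).sum_eq]
  | child l _ ih => simp [meagreCount, ih]
  | fat _ ih => simp [meagreCount, ih]

theorem Step.Phi_eq {s : ℕ} (M : ExpWMethod s) {t t' : PlaneTW} (h : Step t t') :
    Phi M t = Phi M t' := by
  induction h with
  | perm h => funext j; simp only [Phi]; exact (h.map _).prod_eq
  | child l _ ih => funext j; simp [Phi, ih]
  | fat _ ih => funext j; simp [Phi, ih]

theorem Step.rhsAux_eq (γ : ℝ) {t t' : PlaneTW} (h : Step t t') (n : ℕ) :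
    rhsAux γ n t = rhsAux γ n t' := by
  induction h generalizing n with
  | perm h =>
    simp only [rhsAux]; rw [(h.map _).prod_eq, (Step.perm h).meagreCount_eq]
  | child l h ih => simp [rhsAux, ih, (Step.child l h).meagreCount_eq]
  | fat _ ih => simp [rhsAux, ih]

theorem Step.exactCoeff_eq {t t' : PlaneTW} (h : Step t t') : exactCoeff t = exactCoeff t' := by
  induction h with
  | perm h =>
    simp only [exactCoeff]; rw [(h.map exactCoeff).prod_eq, (Step.perm h).order_eq]
  | child l h ih => simp [exactCoeff, ih, (Step.child l h).order_eq]
  | fat _ ih => simp [exactCoeff]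

end PlaneTW

/-- TW-trees: rooted trees with two kinds of vertices, meagre and fat, in which the end vertices
are meagre and the fat vertices are singly branched; the order of the children is immaterial. -/
def TWTree : Type := Quot PlaneTW.Step

namespace TWTree

/-- The TW-tree represented by a plane tree. -/
def mk (t : PlaneTW) : TWTree := Quot.mk _ t

/-- The order `|τ|`, the number of vertices. -/
def order : TWTree → ℕ := Quot.lift PlaneTW.order fun _ _ h => h.order_eq

/-- `Φ_j(τ)`. -/
def Phi {s : ℕ} (M : ExpWMethod s) (j : Fin s) : TWTree → ℝ :=
  Quot.lift (fun t => PlaneTW.Phi M t j) fun _ _ h => congrFun (h.Phi_eq M) j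

/-- `P_τ(γ)`. -/
def rhs (γ : ℝ) : TWTree → ℝ := Quot.lift (PlaneTW.rhs γ) fun _ _ h => h.rhsAux_eq γ 0

/-- The B-series coefficients of the exact solution. -/
def exactCoeff : TWTree → ℝ := Quot.lift PlaneTW.exactCoeff fun _ _ h => h.exactCoeff_eq

/-! Operations on B-series `B(a, y) = a(∅) y + ∑ a(τ) h^|τ| / σ(τ) F(τ)(y)`, in terms of the
coefficients. -/

/-- The coefficients of `h f(B(u, y))`, where `u(∅) = 1`. -/
def compF (u : TWTree → ℝ) : TWTree → ℝ :=
  Quot.lift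
    (fun t => match t with
      | .meagre l => (l.map fun c => u (mk c)).prod
      | .fat _ => 0)
    (by
      intro t t' h
      cases h with
      | perm h => exact (h.map _).prod_eq
      | child l h => simp only [List.map_cons, mk, Quot.sound h]
      | fat h => rfl)

/-- The coefficients of `h A B(a, y)`, where `a(∅) = 0`. -/
def mulA (a : TWTree → ℝ) : TWTree → ℝ :=
  Quot.lift
    (fun t => match t with
      | .meagre _ => 0
      | .fat c => a (mk c))
    (by
      intro t t' h
      cases h with
      | perm h => rfl
      | child l h => rfl
      | fat h => simp only [mk, Quot.sound h])

/-- The coefficients of `φ(hγA) B(a, y) = ∑ γ^m / (m + 1)! (hA)^m B(a, y)`, where `a(∅) = 0`.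
Only the terms with `m < |τ|` can contribute to the coefficient of `τ`. -/
def mulPhi (γ : ℝ) (a : TWTree → ℝ) (τ : TWTree) : ℝ :=
  ∑ m ∈ Finset.range τ.order, γ ^ m / (m + 1).factorial * (mulA^[m] a) τ

end TWTree

namespace ExpWMethod

variable {s : ℕ} (M : ExpWMethod s)

/-- The B-series coefficients of the stage `k_i`, computed stage by stage from the definition of
the method. -/
def stageCoeff (i : Fin s) : TWTree → ℝ :=
  TWTree.mulPhi M.γ
    (TWTree.compF (∑ j : Set.Iio i, M.α i j • stageCoeff j) +
      ∑ j : Set.Iio i, M.Γ i j • TWTree.mulA (stageCoeff j))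
termination_by i.val
decreasing_by all_goals exact j.2

/-- The B-series coefficients (at trees) of the numerical solution after one step. -/
def numCoeff (τ : TWTree) : ℝ := ∑ i, M.b i * M.stageCoeff i τ

/-- The order condition `∑_j b_j Φ_j(τ) = P_τ(γ)` that belongs to the tree `τ`. -/
def OrderCondition (τ : TWTree) : Prop := ∑ j, M.b j * τ.Phi M j = τ.rhs M.γ

end ExpWMethod

/-! ### The table of the conditions up to order four -/

open PlaneTW in
/-- The TW-trees up to order four; the elementary differential of each tree is given in the
comment at the end of its line. -/
def tableTree : Fin 21 → TWTree := fun i => TWTree.mk <|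
  ![meagre [], -- f
    meagre [meagre []], -- f' f
    fat (meagre []), -- A f
    meagre [meagre [], meagre []], -- f''(f, f)
    meagre [meagre [meagre []]], -- f' f' f
    meagre [fat (meagre [])], -- f' A f
    fat (meagre [meagre []]), -- A f' f
    fat (fat (meagre [])), -- A A f
    meagre [meagre [], meagre [], meagre []], -- f'''(f, f, f)
    meagre [meagre [], meagre [meagre []]], -- f''(f, f' f)
    meagre [meagre [], fat (meagre [])], -- f''(f, A f)
    meagre [meagre [meagre [], meagre []]], -- f' f''(f, f)
    fat (meagre [meagre [], meagre []]), -- A f''(f, f)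
    meagre [meagre [meagre [meagre []]]], -- f' f' f' f
    meagre [meagre [fat (meagre [])]], -- f' f' A f
    meagre [fat (meagre [meagre []])], -- f' A f' f
    meagre [fat (fat (meagre []))], -- f' A A f
    fat (meagre [meagre [meagre []]]), -- A f' f' f
    fat (meagre [fat (meagre [])]), -- A f' A f
    fat (fat (meagre [meagre []])), -- A A f' f
    fat (fat (fat (meagre [])))] i -- A A A f

/-- The entries `Φ_j` of the table. -/
def tablePhi {s : ℕ} (M : ExpWMethod s) (j : Fin s) : Fin 21 → ℝ :=
  let a := M.α
  let g := M.Γ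
  ![1,
    ∑ k, a j k,
    ∑ k, g j k,
    ∑ k, ∑ l, a j k * a j l,
    ∑ k, ∑ l, a j k * a k l,
    ∑ k, ∑ l, a j k * g k l,
    ∑ k, ∑ l, g j k * a k l,
    ∑ k, ∑ l, g j k * g k l,
    ∑ k, ∑ l, ∑ m, a j k * a j l * a j m,
    ∑ k, ∑ l, ∑ m, a j k * a j l * a l m,
    ∑ k, ∑ l, ∑ m, a j k * a j l * g l m,
    ∑ k, ∑ l, ∑ m, a j k * a k l * a k m,
    ∑ k, ∑ l, ∑ m, g j k * a k l * a k m,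
    ∑ k, ∑ l, ∑ m, a j k * a k l * a l m,
    ∑ k, ∑ l, ∑ m, a j k * a k l * g l m,
    ∑ k, ∑ l, ∑ m, a j k * g k l * a l m,
    ∑ k, ∑ l, ∑ m, a j k * g k l * g l m,
    ∑ k, ∑ l, ∑ m, g j k * a k l * a l m,
    ∑ k, ∑ l, ∑ m, g j k * a k l * g l m,
    ∑ k, ∑ l, ∑ m, g j k * g k l * a l m,
    ∑ k, ∑ l, ∑ m, g j k * g k l * g l m]

/-- The entries `P_τ(γ)` of the table. -/
def tableRhs (γ : ℝ) : Fin 21 → ℝ :=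
  ![1, 1 / 2, -γ / 2, 1 / 3, 1 / 6, -γ / 4, -γ / 4, γ ^ 2 / 3,
    1 / 4, 1 / 8, -γ / 6, 1 / 12, -γ / 6, 1 / 24, -γ / 12, -γ / 12, γ ^ 2 / 6,
    -γ / 12, γ ^ 2 / 8, γ ^ 2 / 6, -γ ^ 3 / 4]

end

/-!
The order of the method is read off from B-series. Both the numerical and the exact solution have
B-series expansions to any order (`ExpWMethod.hasBSeries_step`, `hasBSeries_solution`), so the
method has order `p` as soon as the coefficients `numCoeff` and `exactCoeff` agree on the trees with
at most `p` vertices. The expansions are sums over plane trees: there the weights are products of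
inverse factorials, and no symmetry coefficients have to be counted. For the converse there is one
system for each `n` that tests all trees with at most `n` vertices at once. Its unknowns are indexed
by the trees themselves, `y_t' = ∏ y_c` over the children `c` of a meagre root and `y_t' = 0` for a
fat root, while `A` moves the entry `c` to the entry `fat c`. On this system the method and the
solution starting at zero are given exactly by `a(t) h ^ |t|` in the entry `t`
(`step_treeField`, `hasDerivAt_treeSeries_exactCoeff`), so an error `O(h ^ (p + 1))` forces the
coefficients to agree (`ExpWMethod.HasOrder.numCoeff_eq`).

It remains to compare the coefficients with `Φ_j(τ)` and `P_τ(γ)`. For a chain of fat vertices the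
generating function `K` of the stage coefficients satisfies `K = φ(γX) (v + X Γ K)`, whence
`K = ∑ X ^ q φ(γX) ^ (q + 1) Γ ^ q v`: the coefficient of a chain is a combination of the values of
`Φ` for the shorter chains, with leading coefficient one. The numbers `(-γ)^q / (q + 1)` in `P_τ(γ)`
are those for which the same combination vanishes for all nonempty chains (`sum_chainCoeff_mul`), as
does the coefficient of the exact solution. Therefore the stage coefficients and the exact
coefficient of `τ` differ from `Φ_j(τ)` and `P_τ(γ)` by the same linear combination of the values
for trees with fewer vertices (`ExpWMethod.stageVec_sub_phiVec_mem`), and the conditions of lower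
order make the two defects equal.
-/

/-! ### Taylor's theorem along segments -/

section Taylor

variable {E F : Type*} [NormedAddCommGroup E] [NormedSpace ℝ E]
  [NormedAddCommGroup F] [NormedSpace ℝ F]

theorem iteratedDerivWithin_Icc_segment {f : E → F} {y z : E} {r : ℝ} {N i : ℕ}
    (hf : ContDiffOn ℝ N f (Metric.ball y r)) (hz : ‖z‖ < r) (hi : i ≤ N) {t : ℝ}
    (ht : t ∈ Set.Icc (0 : ℝ) 1) :
    iteratedDerivWithin i (fun t : ℝ => f (y + t • z)) (Set.Icc 0 1) t =
      iteratedFDeriv ℝ i f (y + t • z) fun _ => z := by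
  set g : ℝ →L[ℝ] E := ContinuousLinearMap.toSpanSingleton ℝ z with hg
  set F' : E → F := fun x => f (y + x) with hF'
  have hB : IsOpen (Metric.ball (0 : E) r) := Metric.isOpen_ball
  have hF : ContDiffOn ℝ N F' (Metric.ball 0 r) :=
    hf.comp (contDiff_const.add contDiff_id).contDiffOn fun x hx => by
      simpa [Metric.mem_ball, dist_eq_norm] using hx
  have hmem : g t ∈ Metric.ball (0 : E) r := by
    have h1 : ‖t • z‖ ≤ ‖z‖ := by
      rw [norm_smul, Real.norm_of_nonneg ht.1]
      exact mul_le_of_le_one_left (norm_nonneg _) ht.2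
    simpa [hg] using h1.trans_lt hz
  have hU : IsOpen (g ⁻¹' Metric.ball (0 : E) r) := hB.preimage g.continuous
  have hcomp : ContDiffOn ℝ N (F' ∘ g) (g ⁻¹' Metric.ball (0 : E) r) :=
    hF.comp g.contDiff.contDiffOn fun _ hx => hx
  have hat : ContDiffAt ℝ i (F' ∘ g) t :=
    (hcomp.contDiffAt (hU.mem_nhds hmem)).of_le (by exact_mod_cast hi)
  have h1 := g.iteratedFDerivWithin_comp_right hF hB.uniqueDiffOn hU.uniqueDiffOn hmem
    (i := i) (by exact_mod_cast hi)
  rw [iteratedFDerivWithin_of_isOpen i hB hmem, iteratedFDerivWithin_of_isOpen i hU hmem,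
    iteratedFDeriv_comp_add_left] at h1
  have h2 : iteratedDerivWithin i (F' ∘ g) (Set.Icc 0 1) t =
      iteratedFDeriv ℝ i (F' ∘ g) t fun _ => 1 := by
    rw [iteratedDerivWithin, iteratedFDerivWithin_eq_iteratedFDeriv
      (uniqueDiffOn_Icc zero_lt_one) hat ht]
  change iteratedDerivWithin i (F' ∘ g) (Set.Icc 0 1) t = _
  rw [h2, h1]
  simp [hg]

/-- **Taylor's theorem** in a normed space, with a remainder of the order of the first omitted
term. -/
theorem ContDiffAt.taylor_isBigO {f : E → F} {y : E} (hf : ContDiffAt ℝ ∞ f y) (n : ℕ) :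
    (fun z => f (y + z) - ∑ m ∈ Finset.range (n + 1),
      (m.factorial : ℝ)⁻¹ • iteratedFDeriv ℝ m f y fun _ => z) =O[𝓝 0] fun z => ‖z‖ ^ (n + 1) := by
  have hfn : ContDiffAt ℝ ((n + 1 : ℕ) : ℕ∞ω) f y := hf.of_le (by exact_mod_cast le_top)
  obtain ⟨u, hu, hyu⟩ := hfn.contDiffOn le_rfl (by simp)
  have hcont : ContinuousAt (iteratedFDeriv ℝ (n + 1) f) y :=
    (hf.iteratedFDeriv_right (m := 0) (i := n + 1) (by exact_mod_cast le_top)).continuousAt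
  have hbd : ∀ᶠ x in 𝓝 y, ‖iteratedFDeriv ℝ (n + 1) f x‖ <
      ‖iteratedFDeriv ℝ (n + 1) f y‖ + 1 :=
    hcont.norm.eventually_lt_const (lt_add_one _)
  obtain ⟨r, hr, hball⟩ := Metric.eventually_nhds_iff_ball.1 (hbd.and hu)
  set K := ‖iteratedFDeriv ℝ (n + 1) f y‖ + 1
  have hK : 0 ≤ K := by positivity
  have hfb : ContDiffOn ℝ (n + 1 : ℕ) f (Metric.ball y r) :=
    hyu.mono fun x hx => (hball x hx).2
  refine IsBigO.of_bound K ?_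
  filter_upwards [Metric.ball_mem_nhds (0 : E) hr] with z hz
  have hz' : ‖z‖ < r := by simpa using hz
  have hseg : ∀ t ∈ Set.Icc (0 : ℝ) 1, y + t • z ∈ Metric.ball y r := fun t ht => by
    have h1 : ‖t • z‖ ≤ ‖z‖ := by
      rw [norm_smul, Real.norm_of_nonneg ht.1]
      exact mul_le_of_le_one_left (norm_nonneg _) ht.2
    simpa [Metric.mem_ball, dist_eq_norm] using h1.trans_lt hz'
  have hφ : ContDiffOn ℝ (n + 1 : ℕ) (fun t : ℝ => f (y + t • z)) (Set.Icc 0 1) :=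
    hfb.comp (contDiff_const.add (contDiff_id.smul contDiff_const)).contDiffOn hseg
  have key := taylor_mean_remainder_bound (f := fun t : ℝ => f (y + t • z)) (a := 0) (b := 1)
    (C := K * ‖z‖ ^ (n + 1)) (x := 1) (n := n) zero_le_one (by exact_mod_cast hφ) (by simp)
    (fun t ht => by
      rw [iteratedDerivWithin_Icc_segment hfb hz' le_rfl ht]
      refine (ContinuousMultilinearMap.le_opNorm _ _).trans ?_
      simp only [Finset.prod_const, Finset.card_univ, Fintype.card_fin]
      gcongr
      exact (hball _ (hseg t ht)).1.le)
  rw [taylor_within_apply] at key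
  have hsum : ∑ k ∈ Finset.range (n + 1), ((k.factorial : ℝ)⁻¹ * (1 - 0) ^ k) •
      iteratedDerivWithin k (fun t : ℝ => f (y + t • z)) (Set.Icc 0 1) 0 =
      ∑ m ∈ Finset.range (n + 1), (m.factorial : ℝ)⁻¹ • iteratedFDeriv ℝ m f y fun _ => z := by
    refine Finset.sum_congr rfl fun k hk => ?_
    rw [iteratedDerivWithin_Icc_segment hfb hz' (Finset.mem_range.1 hk).le (by simp)]
    simp
  rw [hsum] at key
  simp only [one_smul, sub_zero, one_pow, mul_one] at key
  refine key.trans ?_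
  rw [norm_pow, norm_norm]
  exact div_le_self (by positivity) (by exact_mod_cast n.factorial_pos)

end Taylor

/-! ### The operator function `φ` -/

section Phi

variable {E : Type*} [NormedAddCommGroup E] [NormedSpace ℝ E]

theorem norm_inv_factorial_smul_pow_le (B : E →L[ℝ] E) (n m : ℕ) :
    ‖((m + n + 1).factorial : ℝ)⁻¹ • B ^ (m + n)‖ ≤ ‖B‖ ^ n * (‖B‖ ^ m / m.factorial) := by
  have hpow : ∀ k : ℕ, ‖B ^ k‖ ≤ ‖B‖ ^ k := fun k => by
    induction k with
    | zero =>
      rw [pow_zero, pow_zero]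
      exact ContinuousLinearMap.norm_id_le (E := E) (𝕜 := ℝ)
    | succ k ih =>
      rw [pow_succ, pow_succ]
      exact (norm_mul_le _ _).trans (by gcongr)
  have hfac : (m.factorial : ℝ) ≤ ((m + n + 1).factorial : ℝ) := by
    exact_mod_cast Nat.factorial_le (by omega)
  have hpos : (0 : ℝ) < m.factorial := by exact_mod_cast m.factorial_pos
  rw [norm_smul, norm_inv, RCLike.norm_natCast]
  calc _ ≤ (m.factorial : ℝ)⁻¹ * ‖B‖ ^ (m + n) := by gcongr; exact hpow _
    _ = _ := by rw [pow_add]; field_simp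

theorem summable_phiOp [CompleteSpace E] (B : E →L[ℝ] E) :
    Summable fun m : ℕ => ((m + 1).factorial : ℝ)⁻¹ • B ^ m :=
  Summable.of_norm_bounded ((Real.summable_pow_div_factorial ‖B‖).mul_left (‖B‖ ^ 0))
    fun m => norm_inv_factorial_smul_pow_le B 0 m

theorem norm_phiOp_sub_sum_le [CompleteSpace E] (B : E →L[ℝ] E) (n : ℕ) :
    ‖phiOp B - ∑ m ∈ Finset.range n, ((m + 1).factorial : ℝ)⁻¹ • B ^ m‖ ≤
      ‖B‖ ^ n * Real.exp ‖B‖ := by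
  rw [phiOp, ← (summable_phiOp B).sum_add_tsum_nat_add n, add_sub_cancel_left]
  refine tsum_of_norm_bounded ?_ fun m => norm_inv_factorial_smul_pow_le B n m
  rw [Real.exp_eq_exp_ℝ]
  exact (NormedSpace.expSeries_div_hasSum_exp ‖B‖).mul_left _

/-- Replacing `φ(hγA)` by its first `n` terms costs `O(h ^ n)` on bounded curves. -/
theorem phiOp_isBigO [CompleteSpace E] (A : E →L[ℝ] E) (γ : ℝ) (n : ℕ) {z : ℝ → E}
    (hz : z =O[𝓝 0] fun _ => (1 : ℝ)) :
    (fun h => phiOp ((h * γ) • A) (z h) - ∑ m ∈ Finset.range n,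
      (γ ^ m / (m + 1).factorial) • h ^ m • (A ^ m) (z h)) =O[𝓝 0] fun h => h ^ n := by
  have h1 : (fun h : ℝ => phiOp ((h * γ) • A) -
      ∑ m ∈ Finset.range n, ((m + 1).factorial : ℝ)⁻¹ • ((h * γ) • A) ^ m) =O[𝓝 0]
      fun h => h ^ n := by
    refine IsBigO.of_bound (‖γ • A‖ ^ n * Real.exp ‖γ • A‖) ?_
    filter_upwards [Metric.ball_mem_nhds (0 : ℝ) zero_lt_one] with h hh
    have hh : ‖h‖ ≤ 1 := by simpa using (Metric.mem_ball.1 hh).le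
    refine (norm_phiOp_sub_sum_le _ n).trans ?_
    rw [mul_smul, norm_smul, mul_pow, norm_pow]
    have : ‖h‖ * ‖γ • A‖ ≤ ‖γ • A‖ := mul_le_of_le_one_left (norm_nonneg _) hh
    calc _ ≤ ‖h‖ ^ n * ‖γ • A‖ ^ n * Real.exp ‖γ • A‖ := by gcongr
      _ = _ := by ring
  have h2 : (fun h : ℝ => (phiOp ((h * γ) • A) -
      ∑ m ∈ Finset.range n, ((m + 1).factorial : ℝ)⁻¹ • ((h * γ) • A) ^ m) (z h)) =O[𝓝 0]
      fun h => h ^ n * (1 : ℝ) :=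
    (IsBigO.of_bound 1 (Eventually.of_forall fun h => by
      rw [one_mul, norm_mul, norm_norm, norm_norm]
      exact (phiOp ((h * γ) • A) - ∑ m ∈ Finset.range n,
        ((m + 1).factorial : ℝ)⁻¹ • ((h * γ) • A) ^ m).le_opNorm (z h))).trans
      (h1.norm_left.mul hz.norm_left)
  simp only [mul_one] at h2
  refine h2.congr_left fun h => ?_
  simp only [sub_apply, sum_apply,
    smul_apply, smul_pow, mul_pow, smul_smul]
  congr 1
  refine Finset.sum_congr rfl fun m _ => ?_
  congr 1
  ring

end Phi

/-! ### Sums over finite sets of plane trees -/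

namespace PlaneTW

theorem order_pos (t : PlaneTW) : 0 < t.order := by
  cases t <;> simp [order]

open Classical in
/-- A finite set of plane trees that contains all trees with at most `n` vertices: step by step, the
trees are formed whose root has its children, at most `n` of them, in the previous set. The trees
with more than `n` vertices that arise are kept, because this makes the substitution of a truncated
B-series into a Taylor polynomial an exact identity. -/
noncomputable def trees : ℕ → Finset PlaneTW
  | 0 => ∅
  | n + 1 => (trees n).image fat ∪ (Finset.range (n + 1)).biUnion fun m =>
      (Fintype.piFinset fun _ : Fin m => trees n).image fun g => meagre (List.ofFn g)

theorem length_le_sum_order (l : List PlaneTW) : l.length ≤ (l.map order).sum := by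
  induction l with
  | nil => simp
  | cons t l ih =>
    have := t.order_pos
    simp only [List.length_cons, List.map_cons, List.sum_cons]
    omega

theorem order_le_sum_order {l : List PlaneTW} {t : PlaneTW} (h : t ∈ l) :
    t.order ≤ (l.map order).sum :=
  List.le_sum_of_mem (List.mem_map_of_mem h)

theorem mem_trees_of_order_le {n : ℕ} : ∀ {t : PlaneTW}, t.order ≤ n → t ∈ trees n := by
  induction n with
  | zero => intro t h; exact absurd t.order_pos (by omega)
  | succ n ih =>
    intro t h
    simp only [trees, Finset.mem_union, Finset.mem_image, Finset.mem_biUnion, Finset.mem_range,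
      Fintype.mem_piFinset]
    cases t with
    | fat c =>
      simp only [order] at h
      exact Or.inl ⟨c, ih (by omega), rfl⟩
    | meagre l =>
      simp only [order] at h
      have h1 := length_le_sum_order l
      refine Or.inr ⟨l.length, by omega, fun i => l.get i, fun i => ih ?_, by simp⟩
      change (l.get i).order ≤ n
      have := order_le_sum_order (List.get_mem l i)
      omega

theorem sum_trees_succ {E : Type*} [AddCommMonoid E] (n : ℕ) (φ : PlaneTW → E) :
    ∑ t ∈ trees (n + 1), φ t = ∑ t ∈ trees n, φ (fat t) +
      ∑ m ∈ Finset.range (n + 1), ∑ g ∈ Fintype.piFinset fun _ : Fin m => trees n,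
        φ (meagre (List.ofFn g)) := by
  classical
  rw [trees, Finset.sum_union, Finset.sum_image, Finset.sum_biUnion]
  · congr 1
    refine Finset.sum_congr rfl fun m _ => ?_
    rw [Finset.sum_image]
    intro g _ g' _ h
    simpa using h
  · intro m _ m' _ hm
    rw [Function.onFun, Finset.disjoint_left]
    intro t h h'
    simp only [Finset.mem_image] at h h'
    obtain ⟨g, _, rfl⟩ := h
    obtain ⟨g', _, h'⟩ := h'
    have := congrArg List.length (meagre.inj h')
    simp only [List.length_ofFn] at this
    exact hm this.symm
  · intro t _ t' _ h
    simpa using h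
  · rw [Finset.disjoint_left]
    intro t h h'
    simp only [Finset.mem_image, Finset.mem_biUnion] at h h'
    obtain ⟨c, _, rfl⟩ := h
    obtain ⟨m, _, g, _, h'⟩ := h'
    exact PlaneTW.noConfusion h'

end PlaneTW

namespace TWTree

theorem ind {p : TWTree → Prop} (h : ∀ t, p (mk t)) (τ : TWTree) : p τ :=
  Quot.ind h τ

theorem order_mk (t : PlaneTW) : (mk t).order = t.order := rfl

theorem mulA_meagre (a : TWTree → ℝ) (l : List PlaneTW) : mulA a (mk (.meagre l)) = 0 := rfl

theorem mulA_fat (a : TWTree → ℝ) (t : PlaneTW) : mulA a (mk (.fat t)) = a (mk t) := rfl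

theorem compF_meagre (u : TWTree → ℝ) (l : List PlaneTW) :
    compF u (mk (.meagre l)) = (l.map fun c => u (mk c)).prod := rfl

theorem compF_fat (u : TWTree → ℝ) (t : PlaneTW) : compF u (mk (.fat t)) = 0 := rfl

theorem mulA_sum_smul {ι : Type*} (s : Finset ι) (c : ι → ℝ) (a : ι → TWTree → ℝ) :
    mulA (∑ i ∈ s, c i • a i) = ∑ i ∈ s, c i • mulA (a i) := by
  funext τ
  induction τ using TWTree.ind with
  | _ t => cases t <;> simp [mulA_meagre, mulA_fat]

theorem iterate_mulA_eq_zero (a : TWTree → ℝ) {m : ℕ} {τ : TWTree} :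
    τ.order ≤ m → (mulA^[m] a) τ = 0 := by
  induction m generalizing τ with
  | zero =>
    induction τ using TWTree.ind with
    | _ t => exact fun h => absurd t.order_pos (Nat.not_lt.2 h)
  | succ m ih =>
    rw [Function.iterate_succ_apply']
    induction τ using TWTree.ind with
    | _ t =>
      intro h
      cases t with
      | meagre l => rfl
      | fat c =>
        rw [order_mk, PlaneTW.order] at h
        exact ih (by rw [order_mk]; omega)

end TWTree

/-! ### Truncated B-series -/

theorem pow_isBigO_pow_nhds_zero {m n : ℕ} (hmn : m ≤ n) :
    (fun h : ℝ => h ^ n) =O[𝓝 0] fun h => h ^ m := by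
  refine IsBigO.of_bound 1 ?_
  filter_upwards [Metric.ball_mem_nhds (0 : ℝ) zero_lt_one] with h hh
  have hh : ‖h‖ ≤ 1 := by simpa using (Metric.mem_ball.1 hh).le
  rw [norm_pow, norm_pow, one_mul]
  exact pow_le_pow_of_le_one (norm_nonneg _) hh hmn

section BSeries

variable {E : Type*} [NormedAddCommGroup E] [NormedSpace ℝ E]

/-- The elementary differential of a plane tree, divided by the factorials of the numbers of
children of its meagre vertices. Summed over the plane trees that represent a TW-tree `τ`, these
weights give `F(τ) / σ(τ)`. -/
noncomputable def weightedDiff (f : E → E) (A : E →L[ℝ] E) (y : E) : PlaneTW → E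
  | .meagre l => (l.length.factorial : ℝ)⁻¹ •
      iteratedFDeriv ℝ l.length f y fun i => weightedDiff f A y (l.get i)
  | .fat t => A (weightedDiff f A y t)
termination_by t => sizeOf t
decreasing_by
  · have := List.sizeOf_get l i
    simp only [PlaneTW.meagre.sizeOf_spec]
    omega
  · simp

/-- The B-series with coefficients `a`, truncated to the trees in `PlaneTW.trees n`. -/
noncomputable def bSum (f : E → E) (A : E →L[ℝ] E) (y : E) (n : ℕ) (a : TWTree → ℝ) (h : ℝ) : E :=
  ∑ t ∈ PlaneTW.trees n, (a (TWTree.mk t) * h ^ t.order) • weightedDiff f A y t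

/-- The curve `z` has a B-series expansion with coefficients `a`, up to an error
`O(h ^ (n + 1))`. -/
def HasBSeries (f : E → E) (A : E →L[ℝ] E) (y : E) (n : ℕ) (z : ℝ → E) (a : TWTree → ℝ) : Prop :=
  (fun h => z h - bSum f A y n a h) =O[𝓝 0] fun h => h ^ (n + 1)

variable {f : E → E} {A : E →L[ℝ] E} {y : E}

theorem weightedDiff_meagre_ofFn {m : ℕ} (g : Fin m → PlaneTW) :
    weightedDiff f A y (.meagre (List.ofFn g)) =
      (m.factorial : ℝ)⁻¹ • iteratedFDeriv ℝ m f y fun i => weightedDiff f A y (g i) := by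
  have key : ∀ (l : List PlaneTW) (k : ℕ) (hk : l.length = k),
      weightedDiff f A y (.meagre l) = (k.factorial : ℝ)⁻¹ •
        iteratedFDeriv ℝ k f y fun i => weightedDiff f A y (l.get (i.cast hk.symm)) := by
    rintro l k rfl
    rw [weightedDiff]
    rfl
  rw [key _ m (by simp)]
  simp

theorem bSum_succ_mulA (n : ℕ) (a : TWTree → ℝ) (h : ℝ) :
    bSum f A y (n + 1) (TWTree.mulA a) h = h • A (bSum f A y n a h) := by
  simp only [bSum, PlaneTW.sum_trees_succ, TWTree.mulA_fat, TWTree.mulA_meagre, zero_mul, zero_smul,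
    Finset.sum_const_zero, add_zero, map_sum, Finset.smul_sum, map_smul, smul_smul, weightedDiff, PlaneTW.order]
  refine Finset.sum_congr rfl fun t _ => ?_
  congr 1
  ring

/-- The truncated B-series with coefficients `compF u`, divided by `h`, is the Taylor polynomial of
`f` at the truncated B-series with coefficients `u`: expand each multilinear term and note that
the tuples of trees are the lists of children of a meagre root. -/
theorem sum_compF_eq_taylor (n : ℕ) (u : TWTree → ℝ) (h : ℝ) :
    ∑ t ∈ PlaneTW.trees (n + 1), (TWTree.compF u (TWTree.mk t) * h ^ (t.order - 1)) •
        weightedDiff f A y t =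
      ∑ m ∈ Finset.range (n + 1),
        (m.factorial : ℝ)⁻¹ • iteratedFDeriv ℝ m f y fun _ => bSum f A y n u h := by
  simp only [bSum, PlaneTW.sum_trees_succ, TWTree.compF_fat, TWTree.compF_meagre, zero_mul, zero_smul,
    Finset.sum_const_zero, zero_add]
  refine Finset.sum_congr rfl fun m _ => ?_
  have h3 := (iteratedFDeriv ℝ m f y).toMultilinearMap.map_sum_finset
    (fun (_ : Fin m) t => (u (TWTree.mk t) * h ^ t.order) • weightedDiff f A y t)
    (fun _ => PlaneTW.trees n)
  simp only [ContinuousMultilinearMap.coe_coe] at h3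
  rw [h3, Finset.smul_sum]
  refine Finset.sum_congr rfl fun g _ => ?_
  rw [ContinuousMultilinearMap.map_smul_univ, weightedDiff_meagre_ofFn, smul_smul, smul_smul]
  congr 1
  simp only [PlaneTW.order, List.map_ofFn, List.prod_ofFn, List.sum_ofFn, Function.comp_apply,
    Finset.prod_mul_distrib, Finset.prod_pow_eq_pow_sum, Nat.add_sub_cancel_left]
  ring

theorem bSum_succ_compF (n : ℕ) (u : TWTree → ℝ) (h : ℝ) :
    bSum f A y (n + 1) (TWTree.compF u) h = h • ∑ m ∈ Finset.range (n + 1),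
      (m.factorial : ℝ)⁻¹ • iteratedFDeriv ℝ m f y fun _ => bSum f A y n u h := by
  rw [← sum_compF_eq_taylor, bSum, Finset.smul_sum]
  refine Finset.sum_congr rfl fun t _ => ?_
  obtain ⟨k, hk⟩ := Nat.exists_eq_succ_of_ne_zero t.order_pos.ne'
  rw [hk, smul_smul, Nat.succ_eq_add_one, Nat.add_sub_cancel, pow_succ]
  congr 1
  ring

/-- Up to `O(h ^ (n + 1))`, a truncated B-series depends only on the coefficients of the trees with
at most `n` vertices. -/
theorem bSum_sub_bSum_isBigO {n m : ℕ} (hnm : n ≤ m) {a b : TWTree → ℝ}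
    (hab : ∀ τ : TWTree, τ.order ≤ n → a τ = b τ) :
    (fun h => bSum f A y m a h - bSum f A y n b h) =O[𝓝 0] fun h => h ^ (n + 1) := by
  classical
  have hlow : ∀ k, n ≤ k → (PlaneTW.trees k).filter (fun t => t.order ≤ n) =
      (PlaneTW.trees n).filter fun t => t.order ≤ n := fun k hk => by
    ext t
    simp only [Finset.mem_filter]
    exact ⟨fun h => ⟨PlaneTW.mem_trees_of_order_le h.2, h.2⟩,
      fun h => ⟨PlaneTW.mem_trees_of_order_le (h.2.trans hk), h.2⟩⟩
  have hhigh : ∀ (k : ℕ) (c : TWTree → ℝ), (fun h : ℝ =>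
      ∑ t ∈ (PlaneTW.trees k).filter (fun t => ¬ t.order ≤ n),
        (c (TWTree.mk t) * h ^ t.order) • weightedDiff f A y t) =O[𝓝 0] fun h => h ^ (n + 1) := by
    intro k c
    refine IsBigO.fun_sum fun t ht => ?_
    have ht := (Finset.mem_filter.1 ht).2
    have h1 : (fun h : ℝ => h ^ t.order) =O[𝓝 0] fun h => h ^ (n + 1) :=
      pow_isBigO_pow_nhds_zero (by omega)
    have h2 := (h1.const_mul_left (c (TWTree.mk t))).smul
      (isBigO_const_const (weightedDiff f A y t) (one_ne_zero (α := ℝ)) (𝓝 0))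
    simpa only [smul_eq_mul, mul_one] using h2
  refine ((hhigh m a).sub (hhigh n b)).congr_left fun h => ?_
  rw [bSum, bSum, ← Finset.sum_filter_add_sum_filter_not (PlaneTW.trees m) (fun t => t.order ≤ n),
    ← Finset.sum_filter_add_sum_filter_not (PlaneTW.trees n) (fun t => t.order ≤ n), hlow m hnm]
  have : ∑ t ∈ (PlaneTW.trees n).filter (fun t => t.order ≤ n),
      (a (TWTree.mk t) * h ^ t.order) • weightedDiff f A y t =
      ∑ t ∈ (PlaneTW.trees n).filter (fun t => t.order ≤ n),
      (b (TWTree.mk t) * h ^ t.order) • weightedDiff f A y t :=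
    Finset.sum_congr rfl fun t ht => by rw [hab (TWTree.mk t) (Finset.mem_filter.1 ht).2]
  rw [this]
  abel

theorem bSum_isBigO (n : ℕ) (a : TWTree → ℝ) :
    (fun h => bSum f A y n a h) =O[𝓝 0] fun h => h := by
  simpa [bSum, PlaneTW.trees] using
    bSum_sub_bSum_isBigO (f := f) (A := A) (y := y) (n.zero_le) (a := a) (b := a)
      fun _ _ => rfl

namespace HasBSeries

variable {n : ℕ} {z z' : ℝ → E} {a a' : TWTree → ℝ}

theorem congr_coeff (hz : HasBSeries f A y n z a) (h : ∀ τ : TWTree, τ.order ≤ n → a τ = a' τ) :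
    HasBSeries f A y n z a' :=
  (IsBigO.add hz (bSum_sub_bSum_isBigO le_rfl h)).congr_left fun _ => sub_add_sub_cancel _ _ _

theorem of_succ (hz : HasBSeries f A y (n + 1) z a) : HasBSeries f A y n z a := by
  have h1 : (fun h : ℝ => h ^ (n + 1 + 1)) =O[𝓝 0] fun h => h ^ (n + 1) :=
    pow_isBigO_pow_nhds_zero (by omega)
  exact ((IsBigO.trans hz h1).add (bSum_sub_bSum_isBigO (Nat.le_succ n) fun _ _ => rfl)).congr_left
    fun _ => sub_add_sub_cancel _ _ _

theorem add (hz : HasBSeries f A y n z a) (hz' : HasBSeries f A y n z' a') :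
    HasBSeries f A y n (fun h => z h + z' h) (a + a') := by
  refine (IsBigO.add hz hz').congr_left fun h => ?_
  simp only [bSum, Pi.add_apply, add_mul, add_smul, Finset.sum_add_distrib]
  abel

theorem const_smul (c : ℝ) (hz : HasBSeries f A y n z a) :
    HasBSeries f A y n (fun h => c • z h) (c • a) := by
  refine (IsBigO.const_smul_left hz c).congr_left fun h => ?_
  simp only [bSum, Pi.smul_apply, smul_eq_mul, mul_assoc, mul_smul, Finset.smul_sum, smul_sub]

theorem zero : HasBSeries f A y n (fun _ => 0) 0 := by
  refine (isBigO_zero _ _).congr_left fun h => ?_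
  simp [bSum]

theorem sum {ι : Type*} (s : Finset ι) {z : ι → ℝ → E} {a : ι → TWTree → ℝ}
    (hz : ∀ i ∈ s, HasBSeries f A y n (z i) (a i)) :
    HasBSeries f A y n (fun h => ∑ i ∈ s, z i h) (∑ i ∈ s, a i) := by
  classical
  induction s using Finset.induction_on with
  | empty => simpa using zero
  | insert i s hi ih =>
    simp only [Finset.sum_insert hi]
    exact (hz i (by simp)).add (ih fun j hj => hz j (by simp [hj]))

theorem isBigO (hz : HasBSeries f A y n z a) : z =O[𝓝 0] fun h => h := by
  have h1 : (fun h : ℝ => h ^ (n + 1)) =O[𝓝 0] fun h => h := by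
    simpa using pow_isBigO_pow_nhds_zero (m := 1) (n := n + 1) (by omega)
  exact ((IsBigO.trans hz h1).add (bSum_isBigO n a)).congr_left fun _ => sub_add_cancel _ _

/-- The rule for the product with `h A`. -/
theorem mulA (hz : HasBSeries f A y n z a) :
    HasBSeries f A y (n + 1) (fun h => h • A (z h)) (TWTree.mulA a) := by
  have h1 := (isBigO_refl (fun h : ℝ => h) (𝓝 0)).smul ((A.isBigO_comp _ _).trans hz)
  refine (h1.congr_left fun h => ?_).congr_right fun h => ?_
  · rw [bSum_succ_mulA, map_sub, smul_sub]
  · rw [smul_eq_mul]; ring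

/-- Taylor's theorem along a curve that has a B-series. -/
theorem taylor_isBigO (hf : ContDiffAt ℝ ∞ f y) (hz : HasBSeries f A y n z a) :
    (fun h => f (y + z h) - ∑ m ∈ Finset.range (n + 1),
      (m.factorial : ℝ)⁻¹ • iteratedFDeriv ℝ m f y fun _ => bSum f A y n a h) =O[𝓝 0]
      fun h => h ^ (n + 1) := by
  have hid : Tendsto (fun h : ℝ => h) (𝓝 0) (𝓝 0) := tendsto_id
  have hb0 : Tendsto (fun h => bSum f A y n a h) (𝓝 0) (𝓝 0) :=
    (bSum_isBigO n a).trans_tendsto hid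
  have hz0 : Tendsto z (𝓝 0) (𝓝 0) := hz.isBigO.trans_tendsto hid
  have hT := ((hf.taylor_isBigO n).comp_tendsto hb0).trans
    (IsBigO.pow (bSum_isBigO (f := f) (A := A) (y := y) n a).norm_left (n + 1))
  have hL : (fun h => f (y + z h) - f (y + bSum f A y n a h)) =O[𝓝 0] fun h : ℝ => h ^ (n + 1) := by
    have h1 := (hf.hasStrictFDerivAt (by simp)).isBigO_sub
    have h2 : Tendsto (fun h => (y + z h, y + bSum f A y n a h)) (𝓝 0) (𝓝 (y, y)) := by
      have h3 := (tendsto_const_nhds (x := y)).add hz0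
      have h4 := (tendsto_const_nhds (x := y)).add hb0
      rw [add_zero] at h3 h4
      exact h3.prodMk_nhds h4
    refine (h1.comp_tendsto h2).trans ?_
    simpa [Function.comp_def, HasBSeries] using hz
  exact (hL.add hT).congr_left fun h => by simp

/-- The rule for the composition with `f`. -/
theorem compF (hf : ContDiffAt ℝ ∞ f y) (hz : HasBSeries f A y n z a) :
    HasBSeries f A y (n + 1) (fun h => h • f (y + z h)) (TWTree.compF a) := by
  have h1 := (isBigO_refl (fun h : ℝ => h) (𝓝 0)).smul (hz.taylor_isBigO hf)
  refine (h1.congr_left fun h => ?_).congr_right fun h => ?_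
  · rw [bSum_succ_compF, smul_sub]
  · rw [smul_eq_mul]; ring

end HasBSeries

end BSeries

/-! ### The B-series of the numerical solution -/

section BSeriesMethod

variable {E : Type*} [NormedAddCommGroup E] [NormedSpace ℝ E] {f : E → E} {A : E →L[ℝ] E} {y : E}

namespace HasBSeries

variable {n : ℕ} {z : ℝ → E} {a : TWTree → ℝ}

theorem iterate_mulA (hz : HasBSeries f A y n z a) (m : ℕ) :
    HasBSeries f A y n (fun h => h ^ m • (A ^ m) (z h)) (TWTree.mulA^[m] a) := by
  induction m with
  | zero => simpa using hz
  | succ m ih =>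
    rw [Function.iterate_succ_apply']
    refine ih.mulA.of_succ.congr_left fun h => ?_
    beta_reduce
    rw [map_smul, smul_smul, ← pow_succ', pow_succ' A, mul_apply_eq_comp]

/-- The rule for the product with `φ(hγA)`. -/
theorem mulPhi [CompleteSpace E] (γ : ℝ) (hz : HasBSeries f A y n z a) :
    HasBSeries f A y n (fun h => phiOp ((h * γ) • A) (z h)) (TWTree.mulPhi γ a) := by
  have h1 : HasBSeries f A y n (fun h => ∑ m ∈ Finset.range (n + 1),
      (γ ^ m / (m + 1).factorial) • h ^ m • (A ^ m) (z h))
      (∑ m ∈ Finset.range (n + 1), (γ ^ m / (m + 1).factorial) • TWTree.mulA^[m] a) :=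
    sum _ fun m _ => (hz.iterate_mulA m).const_smul _
  have h2 : HasBSeries f A y n (fun h => ∑ m ∈ Finset.range (n + 1),
      (γ ^ m / (m + 1).factorial) • h ^ m • (A ^ m) (z h)) (TWTree.mulPhi γ a) := by
    refine h1.congr_coeff fun τ hτ => ?_
    simp only [Finset.sum_apply, Pi.smul_apply, smul_eq_mul, TWTree.mulPhi]
    refine (Finset.sum_subset (Finset.range_mono (by omega)) fun m _ hm => ?_).symm
    rw [TWTree.iterate_mulA_eq_zero a (by simpa using hm), mul_zero]
  have hO : z =O[𝓝 0] fun _ => (1 : ℝ) :=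
    hz.isBigO.trans (by simpa using pow_isBigO_pow_nhds_zero (Nat.zero_le 1))
  exact ((phiOp_isBigO A γ (n + 1) hO).add h2).congr_left fun _ => sub_add_sub_cancel _ _ _

end HasBSeries

/-- The stages have the B-series with the coefficients that the rules give. -/
theorem ExpWMethod.hasBSeries_stage [CompleteSpace E] {s : ℕ} (M : ExpWMethod s)
    (hf : ContDiffAt ℝ ∞ f y) (n : ℕ) (i : Fin s) :
    HasBSeries f A y n (fun h => M.stage f A h y i) (M.stageCoeff i) := by
  induction i using WellFoundedLT.induction with
  | _ i ih =>
    have h1 : ∀ c : Fin s → ℝ, HasBSeries f A y n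
        (fun h => ∑ j : Set.Iio i, c j • M.stage f A h y j)
        (∑ j : Set.Iio i, c j • M.stageCoeff j) := fun c =>
      HasBSeries.sum _ fun j _ => (ih j j.2).const_smul _
    have h2 := (((h1 (M.α i)).compF hf).of_succ.add ((h1 (M.Γ i)).mulA).of_succ).mulPhi M.γ
    rw [TWTree.mulA_sum_smul] at h2
    rw [ExpWMethod.stageCoeff]
    refine h2.congr_left fun h => ?_
    beta_reduce
    rw [ExpWMethod.stage]

theorem ExpWMethod.hasBSeries_step [CompleteSpace E] {s : ℕ} (M : ExpWMethod s)
    (hf : ContDiffAt ℝ ∞ f y) (n : ℕ) :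
    HasBSeries f A y n (fun h => M.step f A h y - y) M.numCoeff := by
  have h1 : HasBSeries f A y n (fun h => ∑ i, M.b i • M.stage f A h y i)
      (∑ i, M.b i • M.stageCoeff i) :=
    HasBSeries.sum _ fun i _ => (M.hasBSeries_stage hf n i).const_smul _
  have h2 : ∑ i, M.b i • M.stageCoeff i = M.numCoeff := by
    funext τ
    simp [ExpWMethod.numCoeff]
  rw [h2] at h1
  exact h1.congr_left fun h => by simp only [ExpWMethod.step, add_sub_cancel_left]

end BSeriesMethod

/-! ### The B-series of the exact solution -/

section Exact

variable {E : Type*} [NormedAddCommGroup E] [NormedSpace ℝ E] {f : E → E} {A : E →L[ℝ] E}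

/-- Integration gains one power of `h`. -/
theorem isBigO_pow_succ_of_hasDerivAt {g g' : ℝ → E} {n : ℕ} (h0 : g 0 = 0)
    (hg : ∀ᶠ h in 𝓝 0, HasDerivAt g (g' h) h) (hg' : g' =O[𝓝 0] fun h => h ^ n) :
    g =O[𝓝 0] fun h => h ^ (n + 1) := by
  obtain ⟨C, hC⟩ := hg'.bound
  obtain ⟨r, hr, hball⟩ := Metric.eventually_nhds_iff_ball.1 (hg.and hC)
  refine IsBigO.of_bound C ?_
  filter_upwards [Metric.ball_mem_nhds (0 : ℝ) hr] with h hh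
  have hh : |h| < r := by simpa using hh
  have hsub : ∀ x ∈ Metric.closedBall (0 : ℝ) |h|, x ∈ Metric.ball (0 : ℝ) r := fun x hx =>
    Metric.closedBall_subset_ball hh hx
  have hC0 : h = 0 ∨ 0 ≤ C := by
    -- At a point other than zero, a negative bound would contradict the sign of the norm.
    by_contra! hcon
    have := ((norm_nonneg _).trans (hball h (hsub h (by simp))).2)
    rw [norm_pow] at this
    have hpos : 0 < ‖h‖ ^ n := pow_pos (norm_pos_iff.2 hcon.1) n
    nlinarith
  rcases hC0 with rfl | hC0
  · simp [h0]
  have key := (convex_closedBall (0 : ℝ) |h|).norm_image_sub_le_of_norm_hasDerivWithin_le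
    (f := g) (f' := g') (C := C * |h| ^ n) (x := 0) (y := h)
    (fun x hx => (hball x (hsub x hx)).1.hasDerivWithinAt)
    (fun x hx => by
      refine (hball x (hsub x hx)).2.trans ?_
      rw [norm_pow]
      have : ‖x‖ ≤ |h| := by simpa using hx
      gcongr) (by simp) (by simp)
  rw [h0, sub_zero, sub_zero] at key
  rwa [norm_pow, pow_succ, ← mul_assoc]

theorem TWTree.exactCoeff_mul_order (t : PlaneTW) :
    TWTree.exactCoeff (TWTree.mk t) * t.order =
      TWTree.compF TWTree.exactCoeff (TWTree.mk t) := by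
  cases t with
  | meagre l =>
    have h0 : ((PlaneTW.meagre l).order : ℝ) ≠ 0 := by
      exact_mod_cast (PlaneTW.order_pos _).ne'
    change PlaneTW.exactCoeff (.meagre l) * _ = (l.map PlaneTW.exactCoeff).prod
    rw [PlaneTW.exactCoeff, div_mul_cancel₀ _ h0]
  | fat c =>
    change PlaneTW.exactCoeff (.fat c) * _ = 0
    rw [PlaneTW.exactCoeff, zero_mul]

theorem hasDerivAt_bSum_exactCoeff (y : E) (n : ℕ) (h : ℝ) :
    HasDerivAt (bSum f A y (n + 1) TWTree.exactCoeff) (∑ m ∈ Finset.range (n + 1),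
      (m.factorial : ℝ)⁻¹ • iteratedFDeriv ℝ m f y fun _ =>
        bSum f A y n TWTree.exactCoeff h) h := by
  rw [← sum_compF_eq_taylor (A := A)]
  refine HasDerivAt.fun_sum fun t _ => ?_
  have h1 := ((hasDerivAt_pow t.order h).const_mul
    (TWTree.exactCoeff (TWTree.mk t))).smul_const (weightedDiff f A y t)
  rwa [← mul_assoc, TWTree.exactCoeff_mul_order] at h1

/-- Each solution has the B-series with the coefficients `exactCoeff`: a truncated expansion of
`y` gives one of `f ∘ y = y'` with an error of the same order, and integrating gains one power
of `h`. -/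
theorem hasBSeries_solution {y : ℝ → E} {t₀ : ℝ} (hf : ContDiffAt ℝ ∞ f (y t₀))
    (hy : ∀ᶠ t in 𝓝 t₀, HasDerivAt y (f (y t)) t) (n : ℕ) :
    HasBSeries f A (y t₀) n (fun h => y (t₀ + h) - y t₀) TWTree.exactCoeff := by
  have htend : Tendsto (fun h : ℝ => t₀ + h) (𝓝 0) (𝓝 t₀) := by
    simpa using (tendsto_const_nhds (x := t₀)).add (tendsto_id (α := ℝ) (x := 𝓝 0))
  have hder : ∀ᶠ h in 𝓝 (0 : ℝ), HasDerivAt (fun h => y (t₀ + h) - y t₀) (f (y (t₀ + h))) h :=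
    (htend.eventually hy).mono fun h hh => by
      simpa using (hh.comp_const_add t₀ h).sub_const (y t₀)
  induction n with
  | zero =>
    have h1 := hder.self_of_nhds.isBigO_sub
    simpa [HasBSeries, bSum, PlaneTW.trees] using h1
  | succ n ih =>
    refine isBigO_pow_succ_of_hasDerivAt ?_ ?_ (ih.taylor_isBigO hf)
    · have : bSum f A (y t₀) (n + 1) TWTree.exactCoeff 0 = 0 :=
        Finset.sum_eq_zero fun t _ => by rw [zero_pow t.order_pos.ne', mul_zero, zero_smul]
      simp [this]
    · filter_upwards [hder] with h hh
      rw [add_sub_cancel]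
      exact hh.sub (hasDerivAt_bSum_exactCoeff _ n h)

end Exact

/-- If the B-series of the numerical and of the exact solution agree up to order `p`, then the
method has order `p`. -/
theorem ExpWMethod.hasOrder_of_numCoeff_eq {s : ℕ} (M : ExpWMethod s) {p : ℕ}
    (h : ∀ τ : TWTree, τ.order ≤ p → M.numCoeff τ = τ.exactCoeff) : M.HasOrder p := by
  intro N f A t₀ y hf hy
  have h1 := (M.hasBSeries_step (A := A) hf p).congr_coeff h
  have h2 := hasBSeries_solution (A := A) hf hy p
  refine ((IsBigO.sub h1 h2).mono nhdsWithin_le_nhds).congr_left fun h => ?_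
  rw [sub_sub_sub_cancel_right, sub_sub_sub_cancel_right]

/-! ### A system whose B-series are exact -/

namespace PlaneTW

theorem mem_trees_succ_of_mem {n : ℕ} {t : PlaneTW} (h : t ∈ trees n) : t ∈ trees (n + 1) := by
  induction n generalizing t with
  | zero => simp [trees] at h
  | succ n ih =>
    simp only [trees, Finset.mem_union, Finset.mem_image, Finset.mem_biUnion, Finset.mem_range,
      Fintype.mem_piFinset] at h ih ⊢
    rcases h with ⟨c, hc, rfl⟩ | ⟨m, hm, g, hg, rfl⟩
    · exact Or.inl ⟨c, ih hc, rfl⟩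
    · exact Or.inr ⟨m, by omega, g, fun i => ih (hg i), rfl⟩

theorem mem_trees_of_fat_mem {n : ℕ} {c : PlaneTW} (h : fat c ∈ trees n) : c ∈ trees n := by
  cases n with
  | zero => simp [trees] at h
  | succ n =>
    refine mem_trees_succ_of_mem ?_
    simp only [trees, Finset.mem_union, Finset.mem_image, Finset.mem_biUnion] at h
    rcases h with ⟨c', hc', h⟩ | ⟨m, _, g, _, h⟩
    · rwa [← fat.inj h]
    · exact PlaneTW.noConfusion h

theorem mem_trees_of_meagre_mem {n : ℕ} {l : List PlaneTW} (h : meagre l ∈ trees n) {c : PlaneTW}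
    (hc : c ∈ l) : c ∈ trees n := by
  cases n with
  | zero => simp [trees] at h
  | succ n =>
    refine mem_trees_succ_of_mem ?_
    simp only [trees, Finset.mem_union, Finset.mem_image, Finset.mem_biUnion,
      Fintype.mem_piFinset] at h
    rcases h with ⟨c', hc', h⟩ | ⟨m, _, g, hg, h⟩
    · exact PlaneTW.noConfusion h
    · rw [← meagre.inj h, List.mem_ofFn] at hc
      obtain ⟨i, rfl⟩ := hc
      exact hg i

end PlaneTW

section TreeSystem

/-- The vector of the values of a function at the trees in `PlaneTW.trees n`, which are numbered
by `Finset.equivFin`. -/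
noncomputable def treeRestrict (n : ℕ) (Y : PlaneTW → ℝ) (i : Fin (PlaneTW.trees n).card) : ℝ :=
  Y ((PlaneTW.trees n).equivFin.symm i)

open Classical in
/-- The extension by zero of a vector indexed by `PlaneTW.trees n` to all plane trees. -/
noncomputable def treeExtend (n : ℕ) (y : Fin (PlaneTW.trees n).card → ℝ) (t : PlaneTW) : ℝ :=
  if h : t ∈ PlaneTW.trees n then y ((PlaneTW.trees n).equivFin ⟨t, h⟩) else 0

/-- The vector field `f` of the system indexed by the trees in `PlaneTW.trees n`: the entry that
belongs to a tree with meagre root is the product of the entries of the children of the root, and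
the entry that belongs to a tree with fat root is zero. -/
noncomputable def treeField (n : ℕ) (y : Fin (PlaneTW.trees n).card → ℝ) :
    Fin (PlaneTW.trees n).card → ℝ :=
  treeRestrict n fun
    | .meagre l => (l.map (treeExtend n y)).prod
    | .fat _ => 0

/-- The matrix that goes with `treeField`: it moves the entry of `c` to the place of `fat c`. -/
noncomputable def treeOp (n : ℕ) :
    (Fin (PlaneTW.trees n).card → ℝ) →L[ℝ] (Fin (PlaneTW.trees n).card → ℝ) :=
  LinearMap.toContinuousLinearMap
    { toFun := fun y => treeRestrict n fun
        | .meagre _ => 0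
        | .fat c => treeExtend n y c
      map_add' := fun y y' => by
        funext i
        simp only [treeRestrict, Pi.add_apply]
        split
        · simp
        · simp only [treeExtend]
          split <;> simp
      map_smul' := fun c y => by
        funext i
        simp only [treeRestrict, Pi.smul_apply, RingHom.id_apply]
        split
        · simp
        · simp only [treeExtend]
          split <;> simp }

/-- The vector with the entries `a(t) h ^ |t|`: for the system `treeField`, it is the B-series with
coefficients `a`, of which each entry consists of a single term. -/
noncomputable def treeSeries (n : ℕ) (a : TWTree → ℝ) (h : ℝ) : Fin (PlaneTW.trees n).card → ℝ :=
  treeRestrict n fun t => a (TWTree.mk t) * h ^ t.order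

variable {n : ℕ}

theorem treeExtend_treeRestrict {Y : PlaneTW → ℝ} {t : PlaneTW} (ht : t ∈ PlaneTW.trees n) :
    treeExtend n (treeRestrict n Y) t = Y t := by
  simp [treeExtend, treeRestrict, ht]

theorem treeRestrict_congr {Y Y' : PlaneTW → ℝ} (h : ∀ t ∈ PlaneTW.trees n, Y t = Y' t) :
    treeRestrict n Y = treeRestrict n Y' :=
  funext fun _ => h _ (Subtype.coe_prop _)

theorem treeField_treeSeries (u : TWTree → ℝ) (h : ℝ) :
    treeField n (treeSeries n u h) =
      treeRestrict n fun t => TWTree.compF u (TWTree.mk t) * h ^ (t.order - 1) := by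
  refine treeRestrict_congr fun t ht => ?_
  cases t with
  | fat c => simp [TWTree.compF_fat]
  | meagre l =>
    have h1 : l.map (treeExtend n (treeSeries n u h)) =
        l.map fun c => u (TWTree.mk c) * h ^ c.order :=
      List.map_congr_left fun c hc =>
        treeExtend_treeRestrict (PlaneTW.mem_trees_of_meagre_mem ht hc)
    have h2 : (l.map fun c => h ^ c.order).prod = h ^ (l.map PlaneTW.order).sum := by
      clear h1 ht
      induction l with
      | nil => simp
      | cons c l ih => simp [ih, pow_add]
    simp only [h1, TWTree.compF_meagre, PlaneTW.order, Nat.add_sub_cancel_left]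
    rw [List.prod_map_mul, h2]

theorem smul_treeField_treeSeries (u : TWTree → ℝ) (h : ℝ) :
    h • treeField n (treeSeries n u h) = treeSeries n (TWTree.compF u) h := by
  rw [treeField_treeSeries]
  funext i
  simp only [treeSeries, treeRestrict, Pi.smul_apply, smul_eq_mul]
  set t := ((PlaneTW.trees n).equivFin.symm i).1
  obtain ⟨k, hk⟩ := Nat.exists_eq_succ_of_ne_zero t.order_pos.ne'
  rw [hk, Nat.succ_eq_add_one, Nat.add_sub_cancel, pow_succ]
  ring

theorem smul_treeOp_treeSeries (a : TWTree → ℝ) (h : ℝ) :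
    h • treeOp n (treeSeries n a h) = treeSeries n (TWTree.mulA a) h := by
  have h1 : h • treeOp n (treeSeries n a h) = treeRestrict n fun t => h * match t with
      | .meagre _ => 0
      | .fat c => treeExtend n (treeSeries n a h) c := rfl
  rw [h1]
  refine treeRestrict_congr fun t ht => ?_
  cases t with
  | meagre l => simp [TWTree.mulA_meagre]
  | fat c =>
    simp only [treeSeries]
    rw [treeExtend_treeRestrict (PlaneTW.mem_trees_of_fat_mem ht), TWTree.mulA_fat, PlaneTW.order,
      pow_add]
    ring

theorem treeSeries_add (a b : TWTree → ℝ) (h : ℝ) :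
    treeSeries n (a + b) h = treeSeries n a h + treeSeries n b h := by
  funext i
  simp [treeSeries, treeRestrict, add_mul]

theorem treeSeries_sum_smul {ι : Type*} (s : Finset ι) (c : ι → ℝ) (a : ι → TWTree → ℝ) (h : ℝ) :
    treeSeries n (∑ i ∈ s, c i • a i) h = ∑ i ∈ s, c i • treeSeries n (a i) h := by
  funext i
  simp [treeSeries, treeRestrict, Finset.sum_mul, mul_assoc]

theorem pow_treeOp_treeSeries (a : TWTree → ℝ) (h : ℝ) (m : ℕ) :
    h ^ m • (treeOp n ^ m) (treeSeries n a h) = treeSeries n (TWTree.mulA^[m] a) h := by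
  induction m with
  | zero => simp
  | succ m ih =>
    rw [Function.iterate_succ_apply', ← smul_treeOp_treeSeries, ← ih, map_smul, smul_smul,
      ← pow_succ', pow_succ' (treeOp n), mul_apply_eq_comp]

theorem phiOp_treeOp_treeSeries (γ : ℝ) (a : TWTree → ℝ) (h : ℝ) :
    phiOp ((h * γ) • treeOp n) (treeSeries n a h) = treeSeries n (TWTree.mulPhi γ a) h := by
  have h1 := ((ContinuousLinearMap.apply ℝ (Fin (PlaneTW.trees n).card → ℝ)
    (treeSeries n a h)).hasSum (summable_phiOp ((h * γ) • treeOp n)).hasSum)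
  have h2 : ∀ m : ℕ, (((m + 1).factorial : ℝ)⁻¹ • ((h * γ) • treeOp n) ^ m) (treeSeries n a h) =
      (γ ^ m / (m + 1).factorial) • treeSeries n (TWTree.mulA^[m] a) h := fun m => by
    rw [← pow_treeOp_treeSeries, smul_pow, smul_apply, smul_apply, smul_smul, smul_smul]
    congr 1
    rw [mul_pow]
    ring
  refine h1.unique (Pi.hasSum.2 fun i => ?_)
  simp only [ContinuousLinearMap.apply_apply, h2]
  set t := ((PlaneTW.trees n).equivFin.symm i).1 with ht
  have h3 : ∀ b : TWTree → ℝ, treeSeries n b h i = b (TWTree.mk t) * h ^ t.order := fun _ => rfl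
  simp only [Pi.smul_apply, smul_eq_mul, h3, TWTree.mulPhi, Finset.sum_mul, TWTree.order_mk,
    mul_assoc]
  refine hasSum_sum_of_ne_finset_zero fun m hm => ?_
  rw [TWTree.iterate_mulA_eq_zero a (by simpa [TWTree.order_mk] using hm)]
  simp

theorem stage_treeField {s : ℕ} (M : ExpWMethod s) (h : ℝ) (i : Fin s) :
    M.stage (treeField n) (treeOp n) h 0 i = treeSeries n (M.stageCoeff i) h := by
  induction i using WellFoundedLT.induction with
  | _ i ih =>
    have h1 : ∀ c : Fin s → ℝ, ∑ j : Set.Iio i, c j • M.stage (treeField n) (treeOp n) h 0 j =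
        treeSeries n (∑ j : Set.Iio i, c j • M.stageCoeff j) h := fun c => by
      rw [treeSeries_sum_smul]
      exact Finset.sum_congr rfl fun j _ => by rw [ih j j.2]
    rw [ExpWMethod.stage, ExpWMethod.stageCoeff, h1, h1, zero_add, smul_treeField_treeSeries,
      smul_treeOp_treeSeries, TWTree.mulA_sum_smul, ← treeSeries_add, phiOp_treeOp_treeSeries]

theorem step_treeField {s : ℕ} (M : ExpWMethod s) (h : ℝ) :
    M.step (treeField n) (treeOp n) h 0 = treeSeries n M.numCoeff h := by
  have h1 : ∑ i, M.b i • M.stageCoeff i = M.numCoeff := by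
    funext τ
    simp [ExpWMethod.numCoeff]
  rw [ExpWMethod.step, zero_add, ← h1, treeSeries_sum_smul]
  simp only [stage_treeField]

theorem hasDerivAt_treeSeries_exactCoeff (x : ℝ) :
    HasDerivAt (treeSeries n TWTree.exactCoeff)
      (treeField n (treeSeries n TWTree.exactCoeff x)) x := by
  rw [treeField_treeSeries, hasDerivAt_pi]
  intro i
  simp only [treeSeries, treeRestrict]
  rw [← TWTree.exactCoeff_mul_order, mul_assoc]
  exact (hasDerivAt_pow _ x).const_mul _

theorem contDiff_treeField : ContDiff ℝ ∞ (treeField n) := by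
  refine contDiff_pi.2 fun i => ?_
  simp only [treeField, treeRestrict]
  split
  · rename_i l _
    have hext : ∀ c : PlaneTW, ContDiff ℝ ∞ fun y => treeExtend n y c := fun c => by
      simp only [treeExtend]
      split
      · exact contDiff_apply ℝ ℝ _
      · exact contDiff_const
    clear * - hext
    induction l with
    | nil => simpa using contDiff_const
    | cons c l ih => simpa using (hext c).mul ih
  · exact contDiff_const

end TreeSystem

/-- If the method has order `p`, then the B-series of the numerical and of the exact solution agree
up to order `p`: apply the method to the system `treeField`, for which each coefficient is, up to a
power of `h`, an entry of the solution. -/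
theorem ExpWMethod.HasOrder.numCoeff_eq {s : ℕ} {M : ExpWMethod s} {p : ℕ} (hM : M.HasOrder p)
    (τ : TWTree) (hτ : τ.order ≤ p) : M.numCoeff τ = τ.exactCoeff := by
  induction τ using TWTree.ind with
  | _ t =>
    have h0 : treeSeries t.order TWTree.exactCoeff 0 = 0 := by
      funext i
      simp [treeSeries, treeRestrict, zero_pow (PlaneTW.order_pos _).ne']
    have h1 := hM _ (treeField t.order) (treeOp t.order) 0 (treeSeries t.order TWTree.exactCoeff)
      contDiff_treeField.contDiffAt (Eventually.of_forall hasDerivAt_treeSeries_exactCoeff)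
    simp only [h0, step_treeField, zero_add] at h1
    have h2 := isBigO_pi.1 h1
      ((PlaneTW.trees t.order).equivFin ⟨t, PlaneTW.mem_trees_of_order_le le_rfl⟩)
    have h3 : (fun h : ℝ => (M.numCoeff (TWTree.mk t) - TWTree.exactCoeff (TWTree.mk t)) *
        h ^ t.order) =O[𝓝[>] 0] fun h => h ^ (p + 1) :=
      h2.congr_left fun h => by simp [treeSeries, treeRestrict, sub_mul]
    by_contra hne
    have h4 : (fun h : ℝ => h ^ (p + 1)) =o[𝓝[>] 0] fun h => h ^ t.order :=
      (isLittleO_pow_pow (Nat.lt_succ_of_le hτ)).mono nhdsWithin_le_nhds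
    have h5 := (isLittleO_const_mul_left_iff (sub_ne_zero.2 hne)).1 (h3.trans_isLittleO h4)
    have h6 : ∃ᶠ h : ℝ in 𝓝[>] 0, h ^ t.order ≠ 0 :=
      (eventually_mem_nhdsWithin.mono fun h hh =>
        pow_ne_zero _ (ne_of_gt (Set.mem_Ioi.1 hh))).frequently
    exact isLittleO_irrefl h6 h5

/-! ### The generating function of the contributions of a chain of fat vertices -/

section ChainSeries

open PowerSeries

/-- The power series `φ(γX) = ∑ γᵐ / (m + 1)! Xᵐ`. -/
noncomputable def phiSeries (γ : ℝ) : PowerSeries ℝ :=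
  PowerSeries.mk fun m => γ ^ m / (m + 1).factorial

/-- The factor with which the tree with `q` fat vertices in a chain contributes to the stage
coefficient of the tree with `n` fat vertices in this chain. -/
noncomputable def chainCoeff (γ : ℝ) (n q : ℕ) : ℝ :=
  coeff n (X ^ q * phiSeries γ ^ (q + 1))

theorem chainCoeff_self (γ : ℝ) (n : ℕ) : chainCoeff γ n n = 1 := by
  have h := coeff_X_pow_mul (phiSeries γ ^ (n + 1)) n 0
  rw [zero_add] at h
  rw [chainCoeff, h, coeff_zero_eq_constantCoeff, map_pow, ← coeff_zero_eq_constantCoeff,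
    phiSeries, coeff_mk]
  simp

theorem derivative_X_mul_phiSeries (γ : ℝ) :
    derivative ℝ (X * phiSeries γ) = 1 + C γ * (X * phiSeries γ) := by
  ext n
  rw [coeff_derivative, coeff_succ_X_mul, map_add, coeff_C_mul]
  cases n with
  | zero => simp [phiSeries]
  | succ n =>
    have h : ((n + 1).factorial : ℝ) ≠ 0 := by exact_mod_cast (n + 1).factorial_ne_zero
    rw [coeff_succ_X_mul, phiSeries, coeff_mk, coeff_mk, coeff_one, if_neg n.succ_ne_zero,
      Nat.factorial_succ (n + 1)]
    push_cast
    have h' : (n : ℝ) + 1 + 1 ≠ 0 := by positivity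
    field_simp
    ring

/-- The weights `(-γ)^q / (q + 1)` solve the triangular system with the matrix `chainCoeff γ`.
Indeed, with `w = X φ(γX)` one has `w' = 1 + γ w`, so that `∑_{q < N} (-γ)^q w^(q+1) / (q + 1)` has
the derivative `w' ∑_{q < N} (-γ w)^q = 1 - (-γ w)^N`. -/
theorem sum_chainCoeff_mul (γ : ℝ) (n : ℕ) :
    ∑ q ∈ Finset.range (n + 1), chainCoeff γ n q * ((-γ) ^ q / (q + 1)) =
      if n = 0 then 1 else 0 := by
  set w : PowerSeries ℝ := X * phiSeries γ with hw
  have h1 : derivative ℝ (∑ q ∈ Finset.range (n + 1), C ((-γ) ^ q / (q + 1)) * w ^ (q + 1)) =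
      1 - (-(C γ * w)) ^ (n + 1) := by
    have h2 : ∀ q : ℕ, derivative ℝ (C ((-γ) ^ q / (q + 1)) * w ^ (q + 1)) =
        derivative ℝ w * (-(C γ * w)) ^ q := fun q => by
      have h3 : (C ((-γ) ^ q / (q + 1)) : PowerSeries ℝ) * ((q + 1 : ℕ) : PowerSeries ℝ) =
          (-C γ) ^ q := by
        have h4 : ((q + 1 : ℕ) : PowerSeries ℝ) = C ((q : ℝ) + 1) := by simp
        have h5 : (q : ℝ) + 1 ≠ 0 := by positivity
        rw [h4, ← map_mul, div_mul_cancel₀ _ h5, map_pow, map_neg]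
      rw [← smul_eq_C_mul, Derivation.map_smul, smul_eq_C_mul, Derivation.leibniz_pow, nsmul_eq_mul,
        Nat.add_sub_cancel, smul_eq_mul, ← mul_assoc, h3]
      ring
    rw [map_sum, Finset.sum_congr rfl fun q _ => h2 q, ← Finset.mul_sum,
      derivative_X_mul_phiSeries, ← hw]
    have h6 := mul_neg_geom_sum (-(C γ * w)) (n + 1)
    rwa [sub_neg_eq_add] at h6
  have h7 := congrArg (coeff n) h1
  rw [coeff_derivative, map_sub, coeff_one] at h7
  have h8 : coeff n ((-(C γ * w)) ^ (n + 1)) = 0 := by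
    have : (-(C γ * w)) ^ (n + 1) = X ^ (n + 1) * (-(C γ * phiSeries γ)) ^ (n + 1) := by
      rw [hw, ← mul_pow]
      ring
    rw [this, coeff_X_pow_mul', if_neg (by omega)]
  have h9 : ∀ q : ℕ, coeff (n + 1) (C ((-γ) ^ q / (q + 1)) * w ^ (q + 1)) =
      chainCoeff γ n q * ((-γ) ^ q / (q + 1)) := fun q => by
    have : w ^ (q + 1) = X * (X ^ q * phiSeries γ ^ (q + 1)) := by rw [hw]; ring
    rw [coeff_C_mul, this, coeff_succ_X_mul, chainCoeff, mul_comm]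
  rw [h8, sub_zero, map_sum, Finset.sum_congr rfl fun q _ => h9 q] at h7
  rcases eq_or_ne n 0 with rfl | hn
  · simpa using h7
  · rw [if_neg hn] at h7 ⊢
    exact (mul_eq_zero.1 h7).resolve_right (by positivity)

/-- The fixed point equation `K = φ(γX) (v + X Γ K)`, iterated `N` times. -/
theorem eq_sum_of_chain_equation {ι : Type*} [Fintype ι] [DecidableEq ι] (γ : ℝ)
    (G : Matrix ι ι ℝ) (v : ι → ℝ) (K : ι → PowerSeries ℝ)
    (hK : ∀ i, K i = phiSeries γ * (C (v i) + X * ∑ j, C (G i j) * K j)) (N : ℕ) (i : ι) :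
    K i = ∑ q ∈ Finset.range N, C ((G ^ q).mulVec v i) * (X ^ q * phiSeries γ ^ (q + 1)) +
      X ^ N * (phiSeries γ ^ N * ∑ j, C ((G ^ N) i j) * K j) := by
  induction N with
  | zero => simp [Matrix.one_apply]
  | succ N ih =>
    have h1 : ∑ j, C ((G ^ N) i j) * K j = phiSeries γ * C ((G ^ N).mulVec v i) +
        X * (phiSeries γ * ∑ j, C ((G ^ (N + 1)) i j) * K j) := by
      have h2 : ∑ j, C ((G ^ (N + 1)) i j) * K j =
          ∑ j, C ((G ^ N) i j) * ∑ k, C (G j k) * K k := by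
        simp only [pow_succ, Matrix.mul_apply, map_sum, map_mul, Finset.sum_mul, Finset.mul_sum]
        rw [Finset.sum_comm]
        simp only [mul_assoc]
      rw [h2, Matrix.mulVec, dotProduct, map_sum, Finset.mul_sum, Finset.mul_sum, Finset.mul_sum,
        ← Finset.sum_add_distrib]
      refine Finset.sum_congr rfl fun j _ => ?_
      rw [hK j, map_mul]
      ring
    rw [Finset.sum_range_succ, add_assoc]
    refine ih.trans (congrArg _ ?_)
    rw [h1]
    ring

theorem coeff_eq_sum_chainCoeff {ι : Type*} [Fintype ι] [DecidableEq ι] (γ : ℝ)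
    (G : Matrix ι ι ℝ) (v : ι → ℝ) (K : ι → PowerSeries ℝ)
    (hK : ∀ i, K i = phiSeries γ * (C (v i) + X * ∑ j, C (G i j) * K j)) (n : ℕ) (i : ι) :
    coeff n (K i) = ∑ q ∈ Finset.range (n + 1), chainCoeff γ n q * (G ^ q).mulVec v i := by
  rw [eq_sum_of_chain_equation γ G v K hK (n + 1) i, map_add, map_sum, coeff_X_pow_mul',
    if_neg (by omega), add_zero]
  refine Finset.sum_congr rfl fun q _ => ?_
  rw [coeff_C_mul, chainCoeff, mul_comm]

end ChainSeries

/-! ### The stage coefficients along a chain of fat vertices -/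

namespace PlaneTW

/-- Structural induction, with the hypothesis for all children of a meagre root. -/
theorem induct {p : PlaneTW → Prop} (meagre : ∀ l, (∀ c ∈ l, p c) → p (.meagre l))
    (fat : ∀ t, p t → p (.fat t)) : ∀ t, p t
  | .meagre l => meagre l fun c hc => by
      have := List.sizeOf_lt_of_mem hc
      exact induct meagre fat c
  | .fat t => fat t (induct meagre fat t)
termination_by t => sizeOf t

theorem exists_eq_iterate_fat (t : PlaneTW) : ∃ n l, t = fat^[n] (meagre l) := by
  induction t using induct with
  | meagre l _ => exact ⟨0, l, rfl⟩
  | fat t ih =>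
    obtain ⟨n, l, rfl⟩ := ih
    exact ⟨n + 1, l, (Function.iterate_succ_apply' _ _ _).symm⟩

theorem order_iterate_fat (n : ℕ) (t : PlaneTW) : (fat^[n] t).order = n + t.order := by
  induction n with
  | zero => simp
  | succ n ih => rw [Function.iterate_succ_apply', order, ih]; omega

theorem meagreCount_iterate_fat (n : ℕ) (t : PlaneTW) :
    (fat^[n] t).meagreCount = t.meagreCount := by
  induction n with
  | zero => simp
  | succ n ih => rw [Function.iterate_succ_apply', meagreCount, ih]

theorem Phi_iterate_fat {s : ℕ} (M : ExpWMethod s) (n : ℕ) (t : PlaneTW) :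
    Phi M (fat^[n] t) = (Matrix.of M.Γ ^ n).mulVec (Phi M t) := by
  induction n with
  | zero => simp
  | succ n ih =>
    funext j
    rw [Function.iterate_succ_apply', Phi, ih, pow_succ', ← Matrix.mulVec_mulVec]
    rfl

theorem rhs_iterate_fat (γ : ℝ) (n : ℕ) (l : List PlaneTW) :
    rhs γ (fat^[n] (meagre l)) = (-γ) ^ n / (n + 1) * rhs γ (meagre l) := by
  have h : ∀ n m t, rhsAux γ m (fat^[n] t) = rhsAux γ (n + m) t := by
    intro n
    induction n with
    | zero => simp
    | succ n ih =>
      intro m t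
      rw [Function.iterate_succ_apply', rhsAux, ih]
      congr 1
      omega
  rw [rhs, rhs, h, add_zero, rhsAux, rhsAux]
  simp

theorem exactCoeff_iterate_fat (n : ℕ) (t : PlaneTW) :
    exactCoeff (fat^[n] t) = (if n = 0 then 1 else 0) * exactCoeff t := by
  cases n with
  | zero => simp
  | succ n => rw [Function.iterate_succ_apply', exactCoeff]; simp

/-- A tree with a nonzero coefficient in the exact solution has no fat vertices. -/
theorem exactCoeff_eq_zero_or_order_eq (t : PlaneTW) :
    exactCoeff t = 0 ∨ t.order = t.meagreCount := by
  induction t using induct with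
  | fat t _ => exact Or.inl (by rw [exactCoeff])
  | meagre l ih =>
    by_cases h : ∃ c ∈ l, exactCoeff c = 0
    · obtain ⟨c, hc, h0⟩ := h
      left
      rw [exactCoeff, List.prod_eq_zero (h0 ▸ List.mem_map_of_mem hc), zero_div]
    · push Not at h
      right
      rw [order, meagreCount, List.map_congr_left fun c hc => (ih c hc).resolve_left (h c hc)]

/-- In the recursion for the exact solution, the density may be taken with respect to the meagre
vertices only, as it is in `PlaneTW.rhs`. -/
theorem exactCoeff_meagre (l : List PlaneTW) :
    exactCoeff (meagre l) = (l.map exactCoeff).prod / (meagre l).meagreCount := by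
  rcases exactCoeff_eq_zero_or_order_eq (meagre l) with h | h
  · have h0 : ((meagre l).order : ℝ) ≠ 0 := by exact_mod_cast (order_pos _).ne'
    rw [h]
    rw [exactCoeff, div_eq_zero_iff, or_iff_left h0] at h
    rw [h, zero_div]
  · rw [exactCoeff, h]

end PlaneTW

theorem TWTree.iterate_mulA_iterate_fat (a : TWTree → ℝ) (n m : ℕ) (t : PlaneTW) :
    (mulA^[m] a) (mk (PlaneTW.fat^[m + n] t)) = a (mk (PlaneTW.fat^[n] t)) := by
  induction m with
  | zero => simp
  | succ m ih =>
    rw [Function.iterate_succ_apply', Nat.succ_add, Function.iterate_succ_apply', mulA_fat, ih]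

theorem TWTree.mulPhi_iterate_fat (γ : ℝ) (a : TWTree → ℝ) (n : ℕ) (l : List PlaneTW) :
    mulPhi γ a (mk (PlaneTW.fat^[n] (.meagre l))) = ∑ m ∈ Finset.range (n + 1),
      γ ^ m / (m + 1).factorial * a (mk (PlaneTW.fat^[n - m] (.meagre l))) := by
  have hle : n + 1 ≤ (mk (PlaneTW.fat^[n] (.meagre l))).order := by
    have := (PlaneTW.meagre l).order_pos
    rw [order_mk, PlaneTW.order_iterate_fat]
    omega
  rw [mulPhi, ← Finset.sum_subset (Finset.range_mono hle)]
  · refine Finset.sum_congr rfl fun m hm => ?_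
    obtain ⟨k, rfl⟩ := Nat.exists_eq_add_of_le (Nat.lt_succ_iff.1 (Finset.mem_range.1 hm))
    rw [iterate_mulA_iterate_fat, Nat.add_sub_cancel_left]
  · intro m _ hm
    obtain ⟨k, rfl⟩ := Nat.exists_eq_add_of_lt (not_lt.1 (fun h => hm (Finset.mem_range.2 h)))
    have h1 := iterate_mulA_iterate_fat (mulA^[k + 1] a) 0 n (.meagre l)
    rw [← Function.iterate_add_apply, add_zero, ← add_assoc, Function.iterate_zero, id,
      Function.iterate_succ_apply' mulA k, mulA_meagre] at h1
    rw [h1, mul_zero]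

namespace ExpWMethod

variable {s : ℕ} (M : ExpWMethod s)

theorem sum_Iio_eq_sum {c : Fin s → Fin s → ℝ} (hc : ∀ i j, i ≤ j → c i j = 0) (i : Fin s)
    (x : Fin s → ℝ) : ∑ j : Set.Iio i, c i j * x j = ∑ j, c i j * x j := by
  rw [← Finset.sum_subtype (Finset.Iio i) (p := fun j => j ∈ Set.Iio i) (by simp)
    fun j => c i j * x j]
  refine Finset.sum_subset (Finset.subset_univ _) fun j _ hj => ?_
  rw [hc i j (by simpa using hj), zero_mul]

theorem stageCoeff_meagre (i : Fin s) (l : List PlaneTW) :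
    M.stageCoeff i (TWTree.mk (.meagre l)) =
      (l.map fun c => ∑ j, M.α i j * M.stageCoeff j (TWTree.mk c)).prod := by
  have h := TWTree.mulPhi_iterate_fat M.γ
    (TWTree.compF (∑ j : Set.Iio i, M.α i j • M.stageCoeff j) +
      ∑ j : Set.Iio i, M.Γ i j • TWTree.mulA (M.stageCoeff j)) 0 l
  rw [← stageCoeff] at h
  simp only [zero_add, Finset.sum_range_one, Function.iterate_zero, id, Nat.sub_self, pow_zero,
    Nat.factorial_one, Nat.cast_one, div_one, one_mul, Pi.add_apply, TWTree.compF_meagre,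
    Finset.sum_apply, Pi.smul_apply, TWTree.mulA_meagre, mul_zero, Finset.sum_const_zero,
    add_zero, smul_eq_mul] at h
  simpa only [← sum_Iio_eq_sum M.α_eq_zero i fun j => M.stageCoeff j (TWTree.mk _)] using h

/-- Along a chain of fat vertices, the generating function `K` of the stage coefficients satisfies
`K = φ(γX) (v + X Γ K)`, where `v` belongs to the meagre vertex at the end of the chain. -/
theorem stageCoeff_iterate_fat (i : Fin s) (n : ℕ) (l : List PlaneTW) :
    M.stageCoeff i (TWTree.mk (PlaneTW.fat^[n] (.meagre l))) =
      ∑ q ∈ Finset.range (n + 1), chainCoeff M.γ n q *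
        (Matrix.of M.Γ ^ q).mulVec (fun j => M.stageCoeff j (TWTree.mk (.meagre l))) i := by
  set K : Fin s → PowerSeries ℝ := fun i =>
    PowerSeries.mk fun n => M.stageCoeff i (TWTree.mk (PlaneTW.fat^[n] (.meagre l))) with hK
  have h := coeff_eq_sum_chainCoeff M.γ (Matrix.of M.Γ)
    (fun j => M.stageCoeff j (TWTree.mk (.meagre l))) K ?_ n i
  · rwa [hK, PowerSeries.coeff_mk] at h
  intro i
  ext n
  have h := TWTree.mulPhi_iterate_fat M.γ
    (TWTree.compF (∑ j : Set.Iio i, M.α i j • M.stageCoeff j) +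
      ∑ j : Set.Iio i, M.Γ i j • TWTree.mulA (M.stageCoeff j)) n l
  rw [← stageCoeff] at h
  rw [hK, PowerSeries.coeff_mk, h, PowerSeries.coeff_mul,
    Finset.Nat.sum_antidiagonal_eq_sum_range_succ fun a b => PowerSeries.coeff a (phiSeries M.γ) *
      PowerSeries.coeff b (PowerSeries.C (M.stageCoeff i (TWTree.mk (.meagre l))) +
        PowerSeries.X * ∑ j, PowerSeries.C (Matrix.of M.Γ i j) * K j)]
  refine Finset.sum_congr rfl fun m _ => ?_
  rw [phiSeries, PowerSeries.coeff_mk]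
  congr 1
  cases n - m with
  | zero =>
    rw [stageCoeff_meagre]
    simp [TWTree.compF_meagre, TWTree.mulA_meagre,
      ← sum_Iio_eq_sum M.α_eq_zero i fun j => M.stageCoeff j (TWTree.mk _)]
  | succ k =>
    simp [TWTree.compF_fat, TWTree.mulA_fat, Function.iterate_succ_apply',
      ← sum_Iio_eq_sum M.Γ_eq_zero i fun j => M.stageCoeff j (TWTree.mk _),
      PowerSeries.coeff_succ_X_mul, hK]

end ExpWMethod

/-! ### Stage coefficients modulo conditions of lower order -/

namespace ExpWMethod

variable {s : ℕ} (M : ExpWMethod s)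

/-- The values `Φ_j(τ)` together with the right-hand side `P_τ(γ)`. -/
noncomputable def phiVec (t : PlaneTW) : (Fin s → ℝ) × ℝ :=
  (PlaneTW.Phi M t, PlaneTW.rhs M.γ t)

/-- The coefficients of the stages together with that of the exact solution. -/
noncomputable def stageVec (t : PlaneTW) : (Fin s → ℝ) × ℝ :=
  (fun j => M.stageCoeff j (TWTree.mk t), PlaneTW.exactCoeff t)

/-- The linear map that multiplies the values at the stages by the matrix `α`. -/
noncomputable def alphaMap : ((Fin s → ℝ) × ℝ) →ₗ[ℝ] (Fin s → ℝ) × ℝ :=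
  (Matrix.mulVecLin (Matrix.of M.α)).prodMap LinearMap.id

/-- The effect on `phiVec` of replacing a tree `t` with meagre root by `fat^[q] t`. -/
noncomputable def chainMap (q : ℕ) : ((Fin s → ℝ) × ℝ) →ₗ[ℝ] (Fin s → ℝ) × ℝ :=
  (Matrix.mulVecLin (Matrix.of M.Γ ^ q)).prodMap (((-M.γ) ^ q / (q + 1)) • LinearMap.id)

/-- The linear map that divides the last entry by `c`. -/
noncomputable def divLast (s c : ℕ) : ((Fin s → ℝ) × ℝ) →ₗ[ℝ] (Fin s → ℝ) × ℝ :=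
  LinearMap.id.prodMap ((c : ℝ)⁻¹ • LinearMap.id)

theorem fst_list_prod_apply {ι : Type*} (l : List (((ι → ℝ) × ℝ))) (j : ι) :
    l.prod.1 j = (l.map fun v => v.1 j).prod := by
  induction l with
  | nil => simp
  | cons v l ih => simp [ih]

theorem snd_list_prod {ι : Type*} (l : List (((ι → ℝ) × ℝ))) :
    l.prod.2 = (l.map fun v => v.2).prod := by
  induction l with
  | nil => simp
  | cons v l ih => simp [ih]

theorem phiVec_meagre (l : List PlaneTW) :
    M.phiVec (.meagre l) = divLast s (PlaneTW.meagre l).meagreCount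
      (l.map fun c => M.alphaMap (M.phiVec c)).prod := by
  refine Prod.ext (funext fun j => ?_) ?_
  · simp only [phiVec, divLast, LinearMap.prodMap_apply, LinearMap.id_apply, fst_list_prod_apply,
      List.map_map, PlaneTW.Phi]
    rfl
  · simp only [phiVec, divLast, LinearMap.prodMap_apply, LinearMap.smul_apply, LinearMap.id_apply,
      snd_list_prod, List.map_map, PlaneTW.rhs, PlaneTW.rhsAux, smul_eq_mul]
    rw [inv_mul_eq_div]
    simp [Function.comp_def, alphaMap]

theorem stageVec_meagre (l : List PlaneTW) :
    M.stageVec (.meagre l) = divLast s (PlaneTW.meagre l).meagreCount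
      (l.map fun c => M.alphaMap (M.stageVec c)).prod := by
  refine Prod.ext (funext fun j => ?_) ?_
  · simp only [stageVec, divLast, LinearMap.prodMap_apply, LinearMap.id_apply,
      fst_list_prod_apply, List.map_map, stageCoeff_meagre]
    rfl
  · simp only [stageVec, divLast, LinearMap.prodMap_apply, LinearMap.smul_apply,
      LinearMap.id_apply, snd_list_prod, List.map_map, PlaneTW.exactCoeff_meagre, smul_eq_mul]
    rw [inv_mul_eq_div]
    simp [Function.comp_def, alphaMap]

theorem phiVec_iterate_fat (n : ℕ) (l : List PlaneTW) :
    M.phiVec (PlaneTW.fat^[n] (.meagre l)) = M.chainMap n (M.phiVec (.meagre l)) := by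
  simp [phiVec, chainMap, PlaneTW.Phi_iterate_fat, PlaneTW.rhs_iterate_fat]

theorem stageVec_iterate_fat (n : ℕ) (l : List PlaneTW) :
    M.stageVec (PlaneTW.fat^[n] (.meagre l)) = ∑ q ∈ Finset.range (n + 1),
      chainCoeff M.γ n q • M.chainMap q (M.stageVec (.meagre l)) := by
  refine Prod.ext (funext fun j => ?_) ?_
  · simp [stageVec, chainMap, stageCoeff_iterate_fat, Prod.fst_sum]
  · simp only [stageVec, chainMap, PlaneTW.exactCoeff_iterate_fat, ← sum_chainCoeff_mul M.γ n,
      Prod.snd_sum, Prod.smul_snd, LinearMap.prodMap_apply, LinearMap.smul_apply,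
      LinearMap.id_apply, smul_eq_mul, Finset.sum_mul, mul_assoc]

theorem mul_mem_span {R V : Type*} [CommSemiring R] [Semiring V] [Algebra R V] {P Q S : Set V}
    {x y : V} (hx : x ∈ Submodule.span R P) (hy : y ∈ Submodule.span R Q)
    (h : ∀ p ∈ P, ∀ q ∈ Q, p * q ∈ S) : x * y ∈ Submodule.span R S := by
  have h1 := Submodule.mul_mem_mul hx hy
  rw [Submodule.span_mul_span] at h1
  refine Submodule.span_mono ?_ h1
  rintro _ ⟨p, hp, q, hq, rfl⟩
  exact h p hp q hq

/-- The vectors `phiVec` of the trees that have fewer vertices than `t`, but the same number of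
meagre vertices. The latter is needed in inductive arguments, since the density of the contracted
tree, which enters the last entry of `phiVec`, involves this number. -/
def lowerVecs (t : PlaneTW) : Set ((Fin s → ℝ) × ℝ) :=
  {v | ∃ t' : PlaneTW, t'.order < t.order ∧ t'.meagreCount = t.meagreCount ∧ M.phiVec t' = v}

/-- The claim for the children of a meagre root gives the corresponding claim for the products
over the children, by expanding these products. -/
theorem list_prod_stageVec_sub_mem (l : List PlaneTW)
    (h : ∀ c ∈ l, M.stageVec c - M.phiVec c ∈ Submodule.span ℝ (M.lowerVecs c)) :
    (l.map fun c => M.alphaMap (M.stageVec c)).prod -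
        (l.map fun c => M.alphaMap (M.phiVec c)).prod ∈
      Submodule.span ℝ {v | ∃ l' : List PlaneTW,
        (l'.map PlaneTW.order).sum < (l.map PlaneTW.order).sum ∧
        (l'.map PlaneTW.meagreCount).sum = (l.map PlaneTW.meagreCount).sum ∧
        (l'.map fun c => M.alphaMap (M.phiVec c)).prod = v} := by
  induction l with
  | nil => simp
  | cons c l ih =>
    have hl := ih fun c hc => h c (List.mem_cons_of_mem _ hc)
    have hc : M.alphaMap (M.stageVec c - M.phiVec c) ∈
        Submodule.span ℝ (M.alphaMap '' M.lowerVecs c) := by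
      rw [← Submodule.map_span]
      exact Submodule.mem_map_of_mem (h c (by simp))
    set x := M.alphaMap (M.stageVec c) with hx
    set y := M.alphaMap (M.phiVec c) with hy
    set X := (l.map fun c => M.alphaMap (M.stageVec c)).prod with hX
    set Y := (l.map fun c => M.alphaMap (M.phiVec c)).prod with hY
    rw [map_sub, ← hx, ← hy] at hc
    simp only [List.map_cons, List.prod_cons, List.sum_cons]
    rw [← hx, ← hy, ← hX, ← hY,
      show x * X - y * Y = y * (X - Y) + (x - y) * Y + (x - y) * (X - Y) by ring]
    refine Submodule.add_mem _ (Submodule.add_mem _ ?_ ?_) ?_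
    · refine mul_mem_span (Submodule.mem_span_singleton_self y) hl ?_
      rintro _ rfl _ ⟨l', h1, h2, rfl⟩
      exact ⟨c :: l', by simpa using h1, by simpa using h2, by simp [hy]⟩
    · refine mul_mem_span hc (Submodule.mem_span_singleton_self Y) ?_
      rintro _ ⟨_, ⟨c', h1, h2, rfl⟩, rfl⟩ _ rfl
      exact ⟨c' :: l, by simpa using h1, by simpa using h2, by simp [hY]⟩
    · refine mul_mem_span hc hl ?_
      rintro _ ⟨_, ⟨c', h1, h2, rfl⟩, rfl⟩ _ ⟨l', h3, h4, rfl⟩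
      refine ⟨c' :: l', ?_, ?_, by simp⟩
      · simp only [List.map_cons, List.sum_cons]
        omega
      · simp only [List.map_cons, List.sum_cons]
        omega

/-- The coefficient of a tree in the stages and in the exact solution is `Φ_j(τ)` and `P_τ(γ)`,
up to one and the same linear combination of the values for trees with fewer vertices. -/
theorem stageVec_sub_phiVec_mem (t : PlaneTW) :
    M.stageVec t - M.phiVec t ∈ Submodule.span ℝ (M.lowerVecs t) := by
  induction hN : t.order using Nat.strong_induction_on generalizing t with
  | _ N IH =>
    subst hN
    obtain ⟨n, l, rfl⟩ := t.exists_eq_iterate_fat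
    have hord := PlaneTW.order_iterate_fat n (.meagre l)
    have hml : M.stageVec (.meagre l) - M.phiVec (.meagre l) ∈
        Submodule.span ℝ {v | ∃ l' : List PlaneTW,
          (PlaneTW.meagre l').order < (PlaneTW.meagre l).order ∧
          (PlaneTW.meagre l').meagreCount = (PlaneTW.meagre l).meagreCount ∧
          M.phiVec (.meagre l') = v} := by
      have h1 := M.list_prod_stageVec_sub_mem l fun c hc => by
        refine IH _ ?_ c rfl
        have := PlaneTW.order_le_sum_order hc
        rw [hord, PlaneTW.order]
        omega
      have h2 := Submodule.mem_map_of_mem (f := divLast s (PlaneTW.meagre l).meagreCount) h1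
      rw [map_sub, ← stageVec_meagre, ← phiVec_meagre, Submodule.map_span] at h2
      refine Submodule.span_mono ?_ h2
      rintro _ ⟨_, ⟨l', h3, h4, rfl⟩, rfl⟩
      have h5 : (PlaneTW.meagre l').meagreCount = (PlaneTW.meagre l).meagreCount := by
        simp only [PlaneTW.meagreCount, h4]
      refine ⟨l', by simpa only [PlaneTW.order] using Nat.add_lt_add_left h3 1, h5, ?_⟩
      rw [phiVec_meagre, h5]
    have hlow : ∀ q ≤ n, M.chainMap q (M.stageVec (.meagre l) - M.phiVec (.meagre l)) ∈
        Submodule.span ℝ (M.lowerVecs (PlaneTW.fat^[n] (.meagre l))) := fun q hq => by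
      have h2 := Submodule.mem_map_of_mem (f := M.chainMap q) hml
      rw [Submodule.map_span] at h2
      refine Submodule.span_mono ?_ h2
      rintro _ ⟨_, ⟨l', h3, h4, rfl⟩, rfl⟩
      refine ⟨PlaneTW.fat^[q] (.meagre l'), ?_, ?_, M.phiVec_iterate_fat q l'⟩
      · rw [PlaneTW.order_iterate_fat, hord]
        omega
      · rw [PlaneTW.meagreCount_iterate_fat, PlaneTW.meagreCount_iterate_fat, h4]
    rw [stageVec_iterate_fat, Finset.sum_range_succ, chainCoeff_self, one_smul,
      phiVec_iterate_fat, add_sub_assoc, ← map_sub]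
    refine Submodule.add_mem _ (Submodule.sum_mem _ fun q hq => Submodule.smul_mem _ _ ?_)
      (hlow n le_rfl)
    have hq := Finset.mem_range.1 hq
    rw [← sub_add_cancel (M.stageVec (.meagre l)) (M.phiVec (.meagre l)), map_add]
    refine Submodule.add_mem _ (hlow q hq.le) (Submodule.subset_span ?_)
    refine ⟨PlaneTW.fat^[q] (.meagre l), ?_, ?_, M.phiVec_iterate_fat q l⟩
    · rw [PlaneTW.order_iterate_fat, hord]
      omega
    · rw [PlaneTW.meagreCount_iterate_fat, PlaneTW.meagreCount_iterate_fat]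

/-- The defect `∑ b_j v_j - r` of the order condition whose two sides are given by `(v, r)`. -/
noncomputable def defect : ((Fin s → ℝ) × ℝ) →ₗ[ℝ] ℝ :=
  (∑ j, M.b j • LinearMap.proj j) ∘ₗ LinearMap.fst ℝ _ _ - LinearMap.snd ℝ _ _

theorem defect_apply (v : (Fin s → ℝ) × ℝ) : M.defect v = ∑ j, M.b j * v.1 j - v.2 := by
  simp [defect]

theorem numCoeff_sub_exactCoeff (τ : TWTree)
    (h : ∀ τ' : TWTree, τ'.order < τ.order → M.OrderCondition τ') :
    M.numCoeff τ - τ.exactCoeff = ∑ j, M.b j * τ.Phi M j - τ.rhs M.γ := by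
  induction τ using TWTree.ind with
  | _ t =>
    have h1 : M.defect (M.stageVec t - M.phiVec t) = 0 := by
      have h2 : Submodule.span ℝ (M.lowerVecs t) ≤ LinearMap.ker M.defect := by
        rw [Submodule.span_le]
        rintro _ ⟨t', h3, _, rfl⟩
        rw [SetLike.mem_coe, LinearMap.mem_ker, defect_apply]
        exact sub_eq_zero.2 (h (TWTree.mk t') h3)
      exact h2 (M.stageVec_sub_phiVec_mem t)
    rw [map_sub, sub_eq_zero, defect_apply, defect_apply] at h1
    exact h1

theorem numCoeff_eq_iff_orderCondition (p : ℕ) :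
    (∀ τ : TWTree, τ.order ≤ p → M.numCoeff τ = τ.exactCoeff) ↔
      ∀ τ : TWTree, τ.order ≤ p → M.OrderCondition τ := by
  constructor
  · intro h τ hτ
    induction hN : τ.order using Nat.strong_induction_on generalizing τ with
    | _ N IH =>
      subst hN
      have h1 := M.numCoeff_sub_exactCoeff τ fun τ' h' => IH _ h' τ' (h'.le.trans hτ) rfl
      rw [h τ hτ, sub_self] at h1
      exact sub_eq_zero.1 h1.symm
  · intro h τ hτ
    have h1 := M.numCoeff_sub_exactCoeff τ fun τ' h' => h τ' (h'.le.trans hτ)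
    rw [sub_eq_zero.2 (h τ hτ)] at h1
    exact sub_eq_zero.1 h1

theorem hasOrder_iff_orderCondition (p : ℕ) :
    M.HasOrder p ↔ ∀ τ : TWTree, τ.order ≤ p → M.OrderCondition τ := by
  rw [← numCoeff_eq_iff_orderCondition]
  exact ⟨fun h τ hτ => h.numCoeff_eq τ hτ, M.hasOrder_of_numCoeff_eq⟩

end ExpWMethod

/-! ### The trees with at most four vertices -/

namespace PlaneTW

/-- A numerical invariant of TW-trees that separates the trees with at most four vertices. -/
def code : PlaneTW → ℕ
  | meagre l => 2 * (l.map fun t => code t ^ 2).sum + 1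
  | fat t => 2 * code t

theorem Step.code_eq {t t' : PlaneTW} (h : Step t t') : code t = code t' := by
  induction h with
  | perm h => simp only [code]; rw [(h.map _).sum_eq]
  | child l _ ih => simp [code, ih]
  | fat _ ih => simp [code, ih]

theorem eq_of_order_le_one {t : PlaneTW} (h : t.order ≤ 1) : t = meagre [] := by
  rcases t with (_ | ⟨a, l⟩) | a
  · rfl
  · have := a.order_pos
    simp only [order, List.map_cons, List.sum_cons] at h
    omega
  · have := a.order_pos
    simp only [order] at h
    omega

theorem eq_of_order_le_two {t : PlaneTW} (h : t.order ≤ 2) :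
    t = meagre [] ∨ t = meagre [meagre []] ∨ t = fat (meagre []) := by
  rcases t with (_ | ⟨a, _ | ⟨b, l⟩⟩) | a
  · simp
  · simp only [order, List.map_cons, List.map_nil, List.sum_cons, List.sum_nil] at h
    simp [eq_of_order_le_one (t := a) (by omega)]
  · have := a.order_pos
    have := b.order_pos
    simp only [order, List.map_cons, List.sum_cons] at h
    omega
  · simp only [order] at h
    simp [eq_of_order_le_one (t := a) (by omega)]

theorem eq_of_order_le_three {t : PlaneTW} (h : t.order ≤ 3) :
    t = meagre [] ∨ t = meagre [meagre []] ∨ t = fat (meagre []) ∨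
    t = meagre [meagre [], meagre []] ∨ t = meagre [meagre [meagre []]] ∨
    t = meagre [fat (meagre [])] ∨ t = fat (meagre [meagre []]) ∨ t = fat (fat (meagre [])) := by
  rcases t with (_ | ⟨a, _ | ⟨b, _ | ⟨c, l⟩⟩⟩) | a
  · simp
  · simp only [order, List.map_cons, List.map_nil, List.sum_cons, List.sum_nil] at h
    rcases eq_of_order_le_two (t := a) (by omega) with rfl | rfl | rfl <;> simp
  · have := a.order_pos
    have := b.order_pos
    simp only [order, List.map_cons, List.map_nil, List.sum_cons, List.sum_nil] at h
    simp [eq_of_order_le_one (t := a) (by omega), eq_of_order_le_one (t := b) (by omega)]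
  · have := a.order_pos
    have := b.order_pos
    have := c.order_pos
    simp only [order, List.map_cons, List.sum_cons] at h
    omega
  · simp only [order] at h
    rcases eq_of_order_le_two (t := a) (by omega) with rfl | rfl | rfl <;> simp

end PlaneTW

theorem TWTree.mk_meagre_swap (a b : PlaneTW) :
    mk (.meagre [a, b]) = mk (.meagre [b, a]) :=
  Quot.sound (.perm (.swap b a []))

open PlaneTW in
theorem exists_tableTree_eq {t : PlaneTW} (h : t.order ≤ 4) : ∃ i, tableTree i = TWTree.mk t := by
  rcases t with (_ | ⟨a, _ | ⟨b, _ | ⟨c, _ | ⟨d, l⟩⟩⟩⟩) | a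
  · exact ⟨0, rfl⟩
  · simp only [order, List.map_cons, List.map_nil, List.sum_cons, List.sum_nil] at h
    rcases eq_of_order_le_three (t := a) (by omega) with
      rfl | rfl | rfl | rfl | rfl | rfl | rfl | rfl
    exacts [⟨1, rfl⟩, ⟨4, rfl⟩, ⟨5, rfl⟩, ⟨11, rfl⟩, ⟨13, rfl⟩, ⟨14, rfl⟩, ⟨15, rfl⟩, ⟨16, rfl⟩]
  · have ha := a.order_pos
    have hb := b.order_pos
    simp only [order, List.map_cons, List.map_nil, List.sum_cons, List.sum_nil] at h
    rcases eq_of_order_le_two (t := a) (by omega) with rfl | rfl | rfl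
    · rcases eq_of_order_le_two (t := b) (by omega) with rfl | rfl | rfl
      exacts [⟨3, rfl⟩, ⟨9, rfl⟩, ⟨10, rfl⟩]
    · simp only [order, List.map_cons, List.map_nil, List.sum_cons, List.sum_nil] at h
      rw [eq_of_order_le_one (t := b) (by omega), TWTree.mk_meagre_swap]
      exact ⟨9, rfl⟩
    · simp only [order, List.map_nil, List.sum_nil] at h
      rw [eq_of_order_le_one (t := b) (by omega), TWTree.mk_meagre_swap]
      exact ⟨10, rfl⟩
  · have ha := a.order_pos
    have hb := b.order_pos
    have hc := c.order_pos
    simp only [order, List.map_cons, List.map_nil, List.sum_cons, List.sum_nil] at h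
    rw [eq_of_order_le_one (t := a) (by omega), eq_of_order_le_one (t := b) (by omega),
      eq_of_order_le_one (t := c) (by omega)]
    exact ⟨8, rfl⟩
  · have ha := a.order_pos
    have hb := b.order_pos
    have hc := c.order_pos
    have hd := d.order_pos
    simp only [order, List.map_cons, List.sum_cons] at h
    omega
  · simp only [order] at h
    rcases eq_of_order_le_three (t := a) (by omega) with
      rfl | rfl | rfl | rfl | rfl | rfl | rfl | rfl
    exacts [⟨2, rfl⟩, ⟨6, rfl⟩, ⟨7, rfl⟩, ⟨12, rfl⟩, ⟨17, rfl⟩, ⟨18, rfl⟩, ⟨19, rfl⟩, ⟨20, rfl⟩]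

theorem order_tableTree_le (i : Fin 21) : (tableTree i).order ≤ 4 := by
  fin_cases i <;> simp [tableTree, TWTree.order_mk, PlaneTW.order]

theorem range_tableTree : Set.range tableTree = {τ : TWTree | τ.order ≤ 4} := by
  refine Set.Subset.antisymm (Set.range_subset_iff.2 order_tableTree_le) fun τ hτ => ?_
  induction τ using TWTree.ind with
  | _ t => exact exists_tableTree_eq hτ

theorem tableTree_injective : Function.Injective tableTree := by
  let c : TWTree → ℕ := Quot.lift PlaneTW.code fun _ _ h => h.code_eq
  have hmk : ∀ t, c (TWTree.mk t) = t.code := fun _ => rfl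
  have h : c ∘ tableTree = ![1, 3, 2, 5, 19, 9, 6, 4, 7, 21, 11, 51, 10, 723, 163, 73, 33, 38, 18,
      12, 8] := by
    funext i
    fin_cases i <;> simp [tableTree, hmk, PlaneTW.code]
  refine Function.Injective.of_comp (f := c) ?_
  rw [h]
  decide

theorem Phi_tableTree {s : ℕ} (M : ExpWMethod s) (i : Fin 21) (j : Fin s) :
    (tableTree i).Phi M j = tablePhi M j i := by
  have hmk : ∀ t, (TWTree.mk t).Phi M j = PlaneTW.Phi M t j := fun _ => rfl
  fin_cases i <;>
    simp only [tableTree, tablePhi, Fin.zero_eta, Fin.mk_one, Fin.reduceFinMk, Matrix.cons_val,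
      hmk] <;>
    simp only [PlaneTW.Phi, List.map_cons, List.map_nil, List.prod_cons, List.prod_nil, mul_one,
      Finset.sum_mul] <;>
    simp only [Finset.mul_sum, mul_assoc]

theorem rhs_tableTree (γ : ℝ) (i : Fin 21) : (tableTree i).rhs γ = tableRhs γ i := by
  have hmk : ∀ t, (TWTree.mk t).rhs γ = PlaneTW.rhs γ t := fun _ => rfl
  fin_cases i <;>
    simp [tableTree, hmk, PlaneTW.rhs, PlaneTW.rhsAux, PlaneTW.meagreCount, tableRhs] <;> ring

/-! ### The order conditions -/

theorem theorem2 {s : ℕ} (M : ExpWMethod s) :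
    -- order `p` is equivalent to the order conditions for all TW-trees with at most `p` vertices
    (∀ p : ℕ, M.HasOrder p ↔ ∀ τ : TWTree, τ.order ≤ p → M.OrderCondition τ) ∧
    -- the condition for `τ` is what the B-series computation gives, modulo those of lower order
    (∀ τ : TWTree, (∀ τ' : TWTree, τ'.order < τ.order → M.OrderCondition τ') →
      M.numCoeff τ - τ.exactCoeff = ∑ j, M.b j * τ.Phi M j - τ.rhs M.γ) ∧
    -- the table lists the TW-trees with at most four vertices, each exactly once
    Function.Injective tableTree ∧
    Set.range tableTree = {τ : TWTree | τ.order ≤ 4} ∧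
    (∀ i : Fin 21, (∀ j : Fin s, (tableTree i).Phi M j = tablePhi M j i) ∧
      (tableTree i).rhs M.γ = tableRhs M.γ i) ∧
    -- the resulting conditions for `p ≤ 4`
    (∀ p : ℕ, p ≤ 4 → (M.HasOrder p ↔
      ∀ i : Fin 21, (tableTree i).order ≤ p →
        ∑ j, M.b j * tablePhi M j i = tableRhs M.γ i)) := by
  refine ⟨M.hasOrder_iff_orderCondition, M.numCoeff_sub_exactCoeff, tableTree_injective,
    range_tableTree, fun i => ⟨Phi_tableTree M i, rhs_tableTree M.γ i⟩, fun p hp => ?_⟩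
  have hcond : ∀ i, M.OrderCondition (tableTree i) ↔
      ∑ j, M.b j * tablePhi M j i = tableRhs M.γ i := fun i => by
    simp only [ExpWMethod.OrderCondition, Phi_tableTree, rhs_tableTree]
  rw [M.hasOrder_iff_orderCondition]
  refine ⟨fun h i hi => (hcond i).1 (h _ hi), fun h τ hτ => ?_⟩
  obtain ⟨i, rfl⟩ : τ ∈ Set.range tableTree := range_tableTree ▸ hτ.trans hp
  exact (hcond i).2 (h i hτ)
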